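/- Let $X$ be a complex Banach space and $\mathcal L(X)$ the space of bounded linear operators on $X$. For $0<\theta\le\pi$ let $\Sigma_\theta=\{re^{i\varphi}: r>0,\ \varphi\in(-\theta,\theta)\}$. A (linear) relation on $X$ is a subspace $A$ of $X\times X$; it is closed if it is closed in $X\times X$. The resolvent set $\rho(A)$ is the set of all $\lambda\in\mathbb C$ for which the relation $\lambda-A=\{(x,\lambda x-y):(x,y)\in A\}$ is closed, has kernel $\{0\}$ (that is, $(x,0)\in\lambda-A$ only for $x=0$) and has range $X$; for such $\lambda$, the resolvent $R(\lambda,A)\in\mathcal L(X)$ is the operator with $(\lambda-A)^{-1}=\{(y,R(\lambda,A)y):y\in X\}$. For $0<\alpha\le\frac{\pi}{2}$, a holomorphic semigroup on $\Sigma_\alpha$ is a holomorphic map $T:\Sigma_\alpha\to\mathcal L(X)$ with $T(z_1+z_2)=T(z_1)T(z_2)$ for all $z_1,z_2\in\Sigma_\alpha$ (it may be degenerate: $T(z)x=0$ for all $z$ is allowed for some $x\ne0$). If $\sup_{t>0}\|T(t)\|<\infty$, the generator of $T$ is the unique closed relation $A$ with $(0,\infty)\subset\rho(A)$ and $R(\lambda,A)x=\int_0^\infty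 e^{-\lambda t}T(t)x\,dt$ for all $\lambda>0$, $x\in X$. Theorem. Let $\alpha\in(0,\frac{\pi}{2}]$ and $M>0$. (a) Let $A\subset X\times X$ be a closed relation such that $\Sigma_{\alpha+\frac{\pi}{2}}\subset\rho(A)$ and $\|\lambda R(\lambda,A)\|\le M$ for all $\lambda\in\Sigma_{\alpha+\frac{\pi}{2}}$. Then $A$ is the generator of a holomorphic semigroup $T:\Sigma_\alpha\to\mathcal L(X)$ which is bounded on $\Sigma_\alpha$ and satisfies $$\|T(z)\|\le M\Bigl(1+\frac{2e\pi}{\sin\varepsilon}\Bigr)\qquad\text{for all } z\in\Sigma_{\alpha-\varepsilon},\ 0<\varepsilon<\alpha.$$ (b) Conversely, let $T:\Sigma_\alpha\to\mathcal L(X)$ be a holomorphic semigroup with $\|T(z)\|\le M$ for all $z\in\Sigma_\alpha$. Then $T$ has a unique generator $A$, and it satisfies $\Sigma_{\alpha+\frac{\pi}{2}}\subset\rho(A)$ and $$\|\lambda R(\lambda,A)\|\le \frac{M}{\sin\varepsilon}\qquad\text{for all }\lambda\in\Sigma_{\alpha+\frac{\pi}{2}-\varepsilon},\ 0<\varepsilon<\frac{\pi}{2}.$$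 -/

import Mathlib

open scoped Real

/-- A (linear) relation on `X`: a subspace of `X × X`. One writes `y ∈ A x` for `(x, y) ∈ A`. -/
abbrev LinRel (X : Type*) [NormedAddCommGroup X] [NormedSpace ℂ X] : Type _ :=
  Submodule ℂ (X × X)

namespace LinRel

variable {X : Type*} [NormedAddCommGroup X] [NormedSpace ℂ X]

/-- The kernel `{x | (x, 0) ∈ A}`. -/
def ker (A : LinRel X) : Submodule ℂ X := A.comap (LinearMap.inl ℂ X X)

/-- The range `{y | ∃ x, (x, y) ∈ A}`. -/
def ran (A : LinRel X) : Submodule ℂ X := A.map (LinearMap.snd ℂ X X)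

/-- The inverse relation `A⁻¹ = {(y, x) | (x, y) ∈ A}`. -/
def inverse (A : LinRel X) : LinRel X :=
  A.map ((LinearMap.snd ℂ X X).prod (LinearMap.fst ℂ X X))

/-- The relation `μ - A = {(x, μ x - y) | (x, y) ∈ A}`. -/
def subFrom (μ : ℂ) (A : LinRel X) : LinRel X :=
  A.map ((LinearMap.fst ℂ X X).prod (μ • LinearMap.fst ℂ X X - LinearMap.snd ℂ X X))

/-- A relation is invertible if it is closed, has trivial kernel and is surjective. -/
structure Invertible (A : LinRel X) : Prop where
  isClosed : IsClosed (A : Set (X × X))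
  ker_eq_bot : A.ker = ⊥
  ran_eq_top : A.ran = ⊤

/-- The resolvent set `ρ(A)`. -/
def resolventSet (A : LinRel X) : Set ℂ := {μ | (subFrom μ A).Invertible}

open Classical in
/-- The resolvent `R(μ, A)`: the bounded operator whose graph is `(μ - A)⁻¹`
(and `0` if there is no such operator). -/
noncomputable def resolvent (A : LinRel X) (μ : ℂ) : X →L[ℂ] X :=
  if h : ∃ Q : X →L[ℂ] X, (Q : X →ₗ[ℂ] X).graph = (subFrom μ A).inverse then h.choose else 0

theorem mem_ker {A : LinRel X} {x : X} : x ∈ A.ker ↔ (x, (0 : X)) ∈ A := Iff.rfl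

theorem mem_ran {A : LinRel X} {y : X} : y ∈ A.ran ↔ ∃ x, (x, y) ∈ A := by
  simp [ran]

theorem mem_inverse {A : LinRel X} {x y : X} : (y, x) ∈ A.inverse ↔ (x, y) ∈ A := by
  constructor
  · rintro ⟨⟨a, b⟩, h, e⟩
    simp only [LinearMap.prod_apply, Function.prod_apply, LinearMap.fst_apply,
      LinearMap.snd_apply, Prod.mk.injEq] at e
    obtain ⟨rfl, rfl⟩ := e
    exact h
  · intro h
    exact ⟨(x, y), h, rfl⟩

theorem mem_subFrom {A : LinRel X} {μ : ℂ} {x y : X} :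
    (x, y) ∈ subFrom μ A ↔ (x, μ • x - y) ∈ A := by
  constructor
  · rintro ⟨⟨a, b⟩, h, e⟩
    simp only [LinearMap.prod_apply, Function.prod_apply, LinearMap.fst_apply,
      LinearMap.sub_apply, LinearMap.smul_apply, LinearMap.snd_apply, Prod.mk.injEq] at e
    obtain ⟨rfl, rfl⟩ := e
    simpa using h
  · intro h
    exact ⟨(x, μ • x - y), h, by simp⟩

/-- On the resolvent set, the graph of `R(μ, A)` is indeed `(μ - A)⁻¹`. -/
theorem graph_resolvent [CompleteSpace X] {A : LinRel X} {μ : ℂ} (h : μ ∈ A.resolventSet) :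
    (A.resolvent μ : X →ₗ[ℂ] X).graph = (subFrom μ A).inverse := by
  suffices H : ∃ Q : X →L[ℂ] X, (Q : X →ₗ[ℂ] X).graph = (subFrom μ A).inverse by
    rw [resolvent, dif_pos H]
    exact H.choose_spec
  obtain ⟨hc, hk, hr⟩ := h
  have hex : ∀ y, ∃ x, (x, y) ∈ subFrom μ A := fun y => mem_ran.1 (hr ▸ Submodule.mem_top)
  choose q hq using hex
  have huniq : ∀ {x y}, (x, y) ∈ subFrom μ A → x = q y := by
    intro x y hxy
    have h0 : x - q y ∈ (subFrom μ A).ker := by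
      have := (subFrom μ A).sub_mem hxy (hq y)
      simpa [mem_ker] using this
    rw [hk, Submodule.mem_bot] at h0
    exact sub_eq_zero.1 h0
  let L : X →ₗ[ℂ] X :=
    { toFun := q
      map_add' := fun a b => (huniq ((subFrom μ A).add_mem (hq a) (hq b))).symm
      map_smul' := fun c a => (huniq ((subFrom μ A).smul_mem c (hq a))).symm }
  have hL : L.graph = (subFrom μ A).inverse := by
    ext ⟨y, x⟩
    rw [mem_inverse, LinearMap.mem_graph_iff]
    constructor
    · intro e
      have e' : x = q y := e
      rw [e']
      exact hq y
    · exact fun e => huniq e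
  have hcl : IsClosed (L.graph : Set (X × X)) := by
    have : (L.graph : Set (X × X)) = Prod.swap ⁻¹' (subFrom μ A : Set (X × X)) := by
      ext ⟨y, x⟩
      rw [hL]
      exact mem_inverse
    rw [this]
    exact hc.preimage continuous_swap
  exact ⟨ContinuousLinearMap.ofIsClosedGraph hcl, hL⟩

end LinRel

/-- The open sector `Σ_α = {r e^{iθ} | r > 0, |θ| < α}`, for `0 < α ≤ π`
(`Complex.arg` takes values in `(-π, π]`). -/
def openSector (α : ℝ) : Set ℂ := {z | z ≠ 0 ∧ |z.arg| < α}

section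

variable {X : Type*} [NormedAddCommGroup X] [NormedSpace ℂ X]

/-- A holomorphic semigroup on `Σ_α`. Only the values of `T` on `Σ_α` matter. It may be degenerate:
nothing is required as `z → 0`, and the operators `T z` may have a common kernel. -/
structure IsHolomorphicSemigroup (α : ℝ) (T : ℂ → X →L[ℂ] X) : Prop where
  differentiableOn : DifferentiableOn ℂ T (openSector α)
  map_add : ∀ z₁ ∈ openSector α, ∀ z₂ ∈ openSector α, T (z₁ + z₂) = T z₁ ∘L T z₂

/-- `A` is the generator of `T : (0, ∞) → L(X)`: a closed relation whose resolvent on `(0, ∞)` is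
the Laplace transform of `T`. -/
structure IsGenerator (A : LinRel X) (T : ℝ → X →L[ℂ] X) : Prop where
  isClosed : IsClosed (A : Set (X × X))
  mem_resolventSet : ∀ μ : ℝ, 0 < μ → (μ : ℂ) ∈ A.resolventSet
  integrableOn : ∀ μ : ℝ, 0 < μ → ∀ x : X,
    MeasureTheory.IntegrableOn (fun t : ℝ => Real.exp (-(μ * t)) • T t x) (Set.Ioi 0)
  resolvent_eq : ∀ μ : ℝ, 0 < μ → ∀ x : X,
    A.resolvent (μ : ℂ) x = ∫ t in Set.Ioi (0 : ℝ), Real.exp (-(μ * t)) • T t x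

end

open MeasureTheory Filter Topology Set

/-! Part (b). Along each ray of the sector, a bounded semigroup has a Laplace transform satisfying
the resolvent identity (`laplace_sub_laplace`). Any bounded operator is the resolvent at `1` of some
relation, so the transform at `1` determines the generator, and the resolvent identity carries it to
the other points of a half plane. Rotating the ray of integration (`laplace_rotate`) gives the
resolvent on all half planes turned by less than `α`, which fill the sector of angle `α + π / 2`.
The elementary estimate `M / Re (μ e^{iθ})` with the best rotation `θ` gives the constant `1 / sin
ε` (`exists_rotation`).

Part (a). The resolvent family is a pseudo-resolvent, and the semigroup is the integral of `e^{λz}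
R(λ) dλ / 2πi` over a hyperbola around the negative axis. Such integrals satisfy four properties
(`IsSemigroupOf`): holomorphy, commutation with `R`, `R(m) S' = m R(m) S - S`, and `R(m) S(rz) →
R(m)` as `r → 0`. These alone imply the semigroup law and uniqueness (`IsSemigroupOf.mul_eq`,
`IsSemigroupOf.unique`). Uniqueness makes the contour irrelevant. It also gives boundedness along a
ray: `c R(c λ)` obeys the same bound as `R`, so the value at `t z` equals the value at `z` for a
rescaled resolvent, and the contour estimate at `z` does not see which resolvent is used.

For explicit bounds the contour is abandoned. The Laplace transform of `t T(t e^{iθ})` is, up to a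
unimodular factor, the square of the resolvent, which decays like `B / |μ|²`. Fourier inversion on
the line of abscissa `1 / t` then yields `‖T‖ ≤ e B / 2` (`norm_le_of_laplace_bound`). The crude
choice `B = M²` works on the whole sector. Cauchy's estimate for `R' = -R²` gives `B = 4 M / sin ε`
on smaller sectors (`norm_sq_le_of_sin`), better than the required constant. -/

/-! ### Geometry of sectors. -/

theorem openSector_mono {a b : ℝ} (h : a ≤ b) : openSector a ⊆ openSector b :=
  fun _ hz => ⟨hz.1, hz.2.trans_le h⟩

theorem isOpen_openSector {γ : ℝ} (hγ : γ ≤ π) : IsOpen (openSector γ) := by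
  have : openSector γ = Complex.slitPlane ∩ {z | |z.arg| < γ} := by
    ext z
    constructor
    · rintro ⟨h0, h1⟩
      refine ⟨Complex.mem_slitPlane_iff_arg.2 ⟨fun h => ?_, h0⟩, h1⟩
      rw [h, abs_of_pos Real.pi_pos] at h1
      linarith
    · rintro ⟨h0, h1⟩
      exact ⟨Complex.slitPlane_ne_zero h0, h1⟩
  rw [this]
  have hc : ContinuousOn (fun z : ℂ => |z.arg|) Complex.slitPlane := fun z hz =>
    (continuous_abs.continuousAt.comp (Complex.continuousAt_arg hz)).continuousWithinAt
  exact hc.isOpen_inter_preimage Complex.isOpen_slitPlane isOpen_Iio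

/-- The difference of the two sides is `|z| sin (β - |arg z|)`. The linear form makes closure under
addition evident; `β ≤ π / 2` is the convex range. -/
theorem mem_openSector_iff {β : ℝ} (hβ : 0 < β) (hβ' : β ≤ π / 2) {z : ℂ} :
    z ∈ openSector β ↔ |z.im| * Real.cos β < z.re * Real.sin β := by
  have hπ := Real.pi_pos
  by_cases h0 : z = 0
  · simp [h0, openSector]
  have hn : 0 < ‖z‖ := norm_pos_iff.2 h0
  have hre : z.re = ‖z‖ * Real.cos z.arg := (Complex.norm_mul_cos_arg z).symm
  have him : z.im = ‖z‖ * Real.sin z.arg := (Complex.norm_mul_sin_arg z).symm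
  have him' : |z.im| = ‖z‖ * Real.sin |z.arg| := by
    rw [him, abs_mul, abs_of_pos hn]
    congr 1
    rw [Real.abs_sin_eq_sin_abs_of_abs_le_pi (Complex.abs_arg_le_pi z)]
  have hcos : Real.cos z.arg = Real.cos |z.arg| := (Real.cos_abs _).symm
  have key : z.re * Real.sin β - |z.im| * Real.cos β = ‖z‖ * Real.sin (β - |z.arg|) := by
    rw [hre, him', hcos, Real.sin_sub]; ring
  rw [← sub_pos, key]
  constructor
  · rintro ⟨-, h⟩
    exact mul_pos hn (Real.sin_pos_of_pos_of_lt_pi (by linarith) (by linarith [abs_nonneg z.arg]))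
  · intro h
    refine ⟨h0, ?_⟩
    by_contra! hc
    have := Complex.abs_arg_le_pi z
    rcases eq_or_lt_of_le hβ' with e | e
    · have := Real.sin_nonneg_of_nonneg_of_le_pi (x := |z.arg| - β) (by linarith) (by linarith)
      have h2 : Real.sin (β - |z.arg|) = - Real.sin (|z.arg| - β) := by
        rw [← Real.sin_neg, neg_sub]
      nlinarith
    · have := Real.sin_nonneg_of_nonneg_of_le_pi (x := |z.arg| - β) (by linarith) (by linarith)
      have h2 : Real.sin (β - |z.arg|) = - Real.sin (|z.arg| - β) := by
        rw [← Real.sin_neg, neg_sub]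
      nlinarith

theorem add_mem_openSector {β : ℝ} (hβ : 0 < β) (hβ' : β ≤ π / 2) {z w : ℂ}
    (hz : z ∈ openSector β) (hw : w ∈ openSector β) : z + w ∈ openSector β := by
  rw [mem_openSector_iff hβ hβ'] at *
  have hc : 0 ≤ Real.cos β := Real.cos_nonneg_of_mem_Icc ⟨by linarith, hβ'⟩
  have := mul_le_mul_of_nonneg_right (abs_add_le z.im w.im) hc
  simp only [Complex.add_re, Complex.add_im]
  nlinarith

theorem real_mul_mem_openSector {β : ℝ} {z : ℂ} (hz : z ∈ openSector β) {r : ℝ} (hr : 0 < r) :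
    (r : ℂ) * z ∈ openSector β :=
  ⟨mul_ne_zero (by exact_mod_cast hr.ne') hz.1, by rw [Complex.arg_real_mul _ hr]; exact hz.2⟩

theorem ofReal_mem_openSector {β : ℝ} (hβ : 0 < β) {r : ℝ} (hr : 0 < r) :
    (r : ℂ) ∈ openSector β :=
  ⟨by exact_mod_cast hr.ne', by rw [Complex.arg_ofReal_of_nonneg hr.le]; simpa using hβ⟩

theorem mul_mem_openSector {a b : ℝ} (h : a + b ≤ π) {z w : ℂ} (hz : z ∈ openSector a)
    (hw : w ∈ openSector b) : z * w ∈ openSector (a + b) := by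
  have h1 := abs_lt.1 hz.2
  have h2 := abs_lt.1 hw.2
  refine ⟨mul_ne_zero hz.1 hw.1, ?_⟩
  rw [Complex.arg_mul hz.1 hw.1 ⟨by linarith, by linarith⟩]
  exact abs_lt.2 ⟨by linarith, by linarith⟩

theorem arg_exp_ofReal_mul_I {θ : ℝ} (h : |θ| < π) : (Complex.exp (θ * Complex.I)).arg = θ := by
  rw [Complex.arg_exp_mul_I, toIocMod_eq_self]
  have := abs_lt.1 h
  exact ⟨this.1, by linarith⟩

theorem exp_mem_openSector {a θ : ℝ} (h : |θ| < a) (h' : |θ| < π) :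
    Complex.exp (θ * Complex.I) ∈ openSector a :=
  ⟨Complex.exp_ne_zero _, by rwa [arg_exp_ofReal_mul_I h']⟩

theorem mem_openSector_pi_div_two {z : ℂ} : z ∈ openSector (π / 2) ↔ 0 < z.re := by
  rw [mem_openSector_iff (by positivity) le_rfl]
  simp

theorem norm_mul_exp_arg {z : ℂ} : (‖z‖ : ℂ) * Complex.exp (z.arg * Complex.I) = z :=
  Complex.norm_mul_exp_arg_mul_I z

/-- The real part of `w e^{iy}` on the sector of angle `y - π / 2`. -/
theorem re_mul_exp_neg {β : ℝ} (hβ : 0 < β) (hβ' : β ≤ π / 2) {z : ℂ} (hz : z ∈ openSector β) :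
    (z * Complex.exp ((β + π / 2 : ℝ) * Complex.I)).re < 0 ∧
    (z * Complex.exp ((-(β + π / 2) : ℝ) * Complex.I)).re < 0 := by
  rw [mem_openSector_iff hβ hβ'] at hz
  have hc : 0 ≤ Real.cos β := Real.cos_nonneg_of_mem_Icc ⟨by linarith, hβ'⟩
  have h1 := mul_le_mul_of_nonneg_right (le_abs_self z.im) hc
  have h2 := mul_le_mul_of_nonneg_right (neg_abs_le z.im) hc
  simp only [Complex.mul_re, Complex.exp_ofReal_mul_I_re, Complex.exp_ofReal_mul_I_im,
    Real.cos_neg, Real.sin_neg, Real.cos_add_pi_div_two, Real.sin_add_pi_div_two]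
  constructor <;> nlinarith

/-! ### Relations and resolvents as an algebraic equation. -/

namespace LinRel

variable {X : Type*} [NormedAddCommGroup X] [NormedSpace ℂ X]

/-- `Q` is the inverse of `μ - A`. -/
def HasResolvent (A : LinRel X) (μ : ℂ) (Q : X →L[ℂ] X) : Prop :=
  ∀ x z, (x, z) ∈ A ↔ x = Q (μ • x - z)

theorem hasResolvent_iff {A : LinRel X} {μ : ℂ} {Q : X →L[ℂ] X} :
    A.HasResolvent μ Q ↔ (Q : X →ₗ[ℂ] X).graph = (subFrom μ A).inverse := by
  constructor
  · intro h
    ext ⟨y, x⟩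
    rw [mem_inverse, mem_subFrom, h, LinearMap.mem_graph_iff]
    simp
  · intro h x z
    have : (μ • x - z, x) ∈ (Q : X →ₗ[ℂ] X).graph ↔ (μ • x - z, x) ∈ (subFrom μ A).inverse := by
      rw [h]
    rw [mem_inverse, mem_subFrom, LinearMap.mem_graph_iff] at this
    simpa using this.symm

theorem HasResolvent.resolvent_eq {A : LinRel X} {μ : ℂ} {Q : X →L[ℂ] X}
    (h : A.HasResolvent μ Q) : A.resolvent μ = Q := by
  have h' := hasResolvent_iff.1 h
  have H : ∃ Q : X →L[ℂ] X, (Q : X →ₗ[ℂ] X).graph = (subFrom μ A).inverse := ⟨Q, h'⟩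
  rw [resolvent, dif_pos H]
  have h2 := H.choose_spec.trans h'.symm
  ext y
  have : (y, H.choose y) ∈ (H.choose : X →ₗ[ℂ] X).graph := by simp [LinearMap.mem_graph_iff]
  rw [h2, LinearMap.mem_graph_iff] at this
  exact this

theorem HasResolvent.isClosed {A : LinRel X} {μ : ℂ} {Q : X →L[ℂ] X}
    (h : A.HasResolvent μ Q) : IsClosed (A : Set (X × X)) := by
  have : (A : Set (X × X)) = {p | p.1 = Q (μ • p.1 - p.2)} := by
    ext ⟨x, z⟩; exact h x z
  rw [this]
  exact isClosed_eq continuous_fst (by fun_prop)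

theorem HasResolvent.mem_resolventSet {A : LinRel X} {μ : ℂ} {Q : X →L[ℂ] X}
    (h : A.HasResolvent μ Q) : μ ∈ A.resolventSet := by
  have hmem : ∀ x y, (x, y) ∈ subFrom μ A ↔ x = Q y := fun x y => by
    rw [mem_subFrom, h]; simp
  refine ⟨?_, ?_, ?_⟩
  · have : (subFrom μ A : Set (X × X)) = {p | p.1 = Q p.2} := by
      ext ⟨x, z⟩; exact hmem x z
    rw [this]
    exact isClosed_eq continuous_fst (by fun_prop)
  · rw [eq_bot_iff]
    intro x hx
    rw [mem_ker, hmem] at hx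
    simpa using hx
  · rw [eq_top_iff]
    intro y _
    exact mem_ran.2 ⟨Q y, (hmem _ _).2 rfl⟩

theorem hasResolvent_resolvent [CompleteSpace X] {A : LinRel X} {μ : ℂ}
    (h : μ ∈ A.resolventSet) : A.HasResolvent μ (A.resolvent μ) :=
  hasResolvent_iff.2 (graph_resolvent h)

theorem HasResolvent.resolvent_sub {A : LinRel X} {μ ν : ℂ} {Q P : X →L[ℂ] X}
    (hQ : A.HasResolvent μ Q) (hP : A.HasResolvent ν P) : Q - P = (ν - μ) • (P * Q) := by
  ext y
  have h1 : (Q y, μ • Q y - y) ∈ A := (hQ _ _).2 (by simp)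
  have h2 := (hP _ _).1 h1
  have : ν • Q y - (μ • Q y - y) = y + (ν - μ) • Q y := by module
  rw [this] at h2
  simp only [map_add, map_smul] at h2
  simp only [sub_apply, smul_apply]
  exact sub_eq_iff_eq_add'.2 h2

/-- Put `v = ν x - z`, so that membership reads `x = Q v - (ν - μ) Q x`. Applying `P` and the
identity with `P Q` leads to `x = P v`; applying `Q` to `x = P v` and using the identity with `Q P`
leads back. Each inclusion needs its own order of the product. -/
theorem HasResolvent.of_resolvent_identity {A : LinRel X} {μ ν : ℂ} {Q P : X →L[ℂ] X}
    (hQ : A.HasResolvent μ Q) (h1 : Q - P = (ν - μ) • (P * Q))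
    (h2 : Q - P = (ν - μ) • (Q * P)) : A.HasResolvent ν P := by
  have e1 : ∀ v, Q v = P v + (ν - μ) • P (Q v) := fun v => by
    have := DFunLike.congr_fun h1 v
    simp only [sub_apply, smul_apply] at this
    exact sub_eq_iff_eq_add'.1 this
  have e2 : ∀ v, Q v = P v + (ν - μ) • Q (P v) := fun v => by
    have := DFunLike.congr_fun h2 v
    simp only [sub_apply, smul_apply] at this
    exact sub_eq_iff_eq_add'.1 this
  intro x z
  rw [hQ]
  have hv : μ • x - z = (ν • x - z) - (ν - μ) • x := by module
  rw [hv]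
  set v := ν • x - z
  simp only [map_sub, map_smul]
  constructor
  · intro h
    have a1 := congrArg P h
    simp only [map_sub, map_smul] at a1
    have a2 := e1 v
    have a3 := e1 x
    have a4 : Q v = P v + (ν - μ) • (P x + (ν - μ) • P (Q x)) := by
      have a5 : P (Q v) = P x + (ν - μ) • P (Q x) := by rw [a1]; abel
      rw [a2, a5]
    rw [← a3] at a4
    rw [a4] at h
    simpa using h
  · intro h
    have a1 := congrArg Q h
    rw [a1, e2 v]
    simpa using h

/-- The relation whose resolvent at `μ` is `Q`. -/
def ofResolvent (μ : ℂ) (Q : X →L[ℂ] X) : LinRel X where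
  carrier := {p | p.1 = Q (μ • p.1 - p.2)}
  add_mem' := by
    rintro ⟨a, b⟩ ⟨c, d⟩ h1 h2
    simp only [Set.mem_ofPred_eq, Prod.mk_add_mk] at *
    rw [smul_add, add_sub_add_comm, map_add, ← h1, ← h2]
  zero_mem' := by simp
  smul_mem' := by
    rintro k ⟨a, b⟩ h
    simp only [Set.mem_ofPred_eq, Prod.smul_mk] at *
    rw [smul_comm, ← smul_sub, map_smul, ← h]

/-- No injectivity of `Q` is needed: this is the gain from relations over operators, and what admits
degenerate semigroups. -/
theorem hasResolvent_ofResolvent (μ : ℂ) (Q : X →L[ℂ] X) : (ofResolvent μ Q).HasResolvent μ Q :=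
  fun _ _ => Iff.rfl

theorem HasResolvent.unique {A B : LinRel X} {μ : ℂ} {Q : X →L[ℂ] X} (hA : A.HasResolvent μ Q)
    (hB : B.HasResolvent μ Q) : A = B := by
  ext ⟨x, z⟩
  rw [hA, hB]

end LinRel

/-! ### Half-line integrals, rotation of rays, and a bound by Fourier inversion. -/

section Analysis

variable {E : Type*} [NormedAddCommGroup E]

/-- Only the limit of `f` at `0` is meaningful in the applications, so the value there is replaced
by this limit before the fundamental theorem is used. -/
theorem integral_Ioi_zero_of_tendsto [NormedSpace ℝ E] [CompleteSpace E] {f f' : ℝ → E} {m n : E}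
    (hd : ∀ t, 0 < t → HasDerivAt f (f' t) t) (hi : IntegrableOn f' (Ioi 0))
    (h0 : Tendsto f (𝓝[>] 0) (𝓝 n)) (hm : Tendsto f atTop (𝓝 m)) :
    ∫ t in Ioi (0 : ℝ), f' t = m - n := by
  have hev : ∀ t : ℝ, t ≠ 0 → Function.update f 0 n t = f t := fun t ht =>
    Function.update_of_ne ht _ _
  have := integral_Ioi_of_hasDerivAt_of_tendsto (f := Function.update f 0 n) (f' := f') (a := 0)
    (m := m) ?_ ?_ hi ?_
  · simpa using this
  · rw [continuousWithinAt_update_same]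
    simpa using h0
  · intro t ht
    refine (hd t ht).congr_of_eventuallyEq ?_
    filter_upwards [isOpen_ne.mem_nhds (ne_of_gt ht)] with s hs using hev s hs
  · refine hm.congr' ?_
    filter_upwards [eventually_gt_atTop 0] with s hs using (hev s hs.ne').symm

/-- In the coordinate `z = e^w` rays become horizontal lines, and rotating a ray becomes shifting a
line. -/
theorem integral_exp_smul_comp_exp [NormedSpace ℝ E] (g : ℝ → E) :
    ∫ x : ℝ, Real.exp x • g (Real.exp x) = ∫ y in Ioi 0, g y := by
  symm
  rw [← Real.range_exp, ← image_univ]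
  simpa [abs_of_pos (Real.exp_pos _)] using integral_image_eq_integral_abs_deriv_smul
      (MeasurableSet.univ) (fun x _ ↦ (Real.hasDerivAt_exp x).hasDerivWithinAt)
      (fun x _ y _ hxy ↦ Real.exp_injective hxy) g

theorem integrable_exp_smul_comp_exp [NormedSpace ℝ E] (g : ℝ → E) :
    Integrable (fun x : ℝ => Real.exp x • g (Real.exp x)) ↔ IntegrableOn g (Ioi 0) := by
  symm
  rw [← Real.range_exp, ← image_univ]
  simpa [abs_of_pos (Real.exp_pos _)] using integrableOn_image_iff_integrableOn_abs_deriv_smul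
      (MeasurableSet.univ) (fun x _ ↦ (Real.hasDerivAt_exp x).hasDerivWithinAt)
      (fun x _ y _ hxy ↦ Real.exp_injective hxy) g

/-- The integral of a holomorphic function along horizontal lines does not depend on the line. -/
theorem integral_horizontal_eq [NormedSpace ℂ E] [CompleteSpace E] {F : ℂ → E} {a b : ℝ}
    {h : ℝ → ℝ} (hF : DifferentiableOn ℂ F (Complex.im ⁻¹' uIcc a b))
    (hb : ∀ s : ℝ, ∀ y ∈ uIcc a b, ‖F (s + y * Complex.I)‖ ≤ h s)
    (htop : Tendsto h atTop (𝓝 0)) (hbot : Tendsto h atBot (𝓝 0))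
    (ha : Integrable fun s : ℝ => F (s + a * Complex.I))
    (hb' : Integrable fun s : ℝ => F (s + b * Complex.I)) :
    ∫ s : ℝ, F (s + a * Complex.I) = ∫ s : ℝ, F (s + b * Complex.I) := by
  -- Cauchy's theorem on the rectangle with real parts in `[-N, N]`; the vertical sides are
  -- controlled by `h (±N)`.
  have key : ∀ N : ℝ, (∫ s in (-N)..N, F (s + a * Complex.I)) - (∫ s in (-N)..N, F (s + b * Complex.I))
      + Complex.I • (∫ y in a..b, F (N + y * Complex.I))
      - Complex.I • (∫ y in a..b, F ((-N : ℝ) + y * Complex.I)) = 0 := by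
    intro N
    have := Complex.integral_boundary_rect_eq_zero_of_differentiableOn F ⟨-N, a⟩ ⟨N, b⟩
      (hF.mono fun w hw => hw.2)
    simpa using this
  have hv : ∀ N : ℝ, ‖∫ y in a..b, F (N + y * Complex.I)‖ ≤ h N * |b - a| := fun N =>
    intervalIntegral.norm_integral_le_of_norm_le_const fun y hy => hb N y (uIoc_subset_uIcc hy)
  have t1 : Tendsto (fun N : ℝ => ∫ y in a..b, F (N + y * Complex.I)) atTop (𝓝 0) :=
    squeeze_zero_norm hv (by simpa using htop.mul_const |b - a|)
  have t2 : Tendsto (fun N : ℝ => ∫ y in a..b, F ((-N : ℝ) + y * Complex.I)) atTop (𝓝 0) :=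
    squeeze_zero_norm (fun N => hv (-N))
      (by simpa using (hbot.comp tendsto_neg_atTop_atBot).mul_const |b - a|)
  have t3 := intervalIntegral_tendsto_integral ha tendsto_neg_atTop_atBot tendsto_id
  have t4 := intervalIntegral_tendsto_integral hb' tendsto_neg_atTop_atBot tendsto_id
  have t5 := ((t3.sub t4).add (t1.const_smul Complex.I)).sub (t2.const_smul Complex.I)
  simp only [id, key, smul_zero, add_zero, sub_zero] at t5
  exact sub_eq_zero.1 (tendsto_nhds_unique t5 tendsto_const_nhds)

/-- Rotation of the ray of integration in a Laplace integral. -/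
theorem laplace_rotate [NormedSpace ℂ E] [CompleteSpace E] {f : ℂ → E} {α M δ θ : ℝ} {μ : ℂ}
    (hα : α ≤ π) (hf : DifferentiableOn ℂ f (openSector α)) (hM : ∀ z ∈ openSector α, ‖f z‖ ≤ M)
    (hθ : |θ| < α) (hδ : 0 < δ)
    (hμ : ∀ y ∈ uIcc 0 θ, δ ≤ (μ * Complex.exp (y * Complex.I)).re) :
    ∫ t in Ioi (0 : ℝ), Complex.exp (-(μ * t)) • f t =
      ∫ t in Ioi (0 : ℝ), Complex.exp (-(μ * (t * Complex.exp (θ * Complex.I)))) •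
        (Complex.exp (θ * Complex.I) • f (t * Complex.exp (θ * Complex.I))) := by
  -- The form `e^{-μz} f(z) dz` pulled back along `z = e^w`.
  set F : ℂ → E := fun w => Complex.exp w • (Complex.exp (-(μ * Complex.exp w)) • f (Complex.exp w))
  have hα0 : 0 < α := (abs_nonneg θ).trans_lt hθ
  have hy : ∀ y ∈ uIcc 0 θ, |y| < α := by
    intro y hy
    have := Set.abs_sub_left_of_mem_uIcc hy
    simp only [sub_zero] at this
    exact this.trans_lt hθ
  have hmem : ∀ w : ℂ, |w.im| < α → Complex.exp w ∈ openSector α := by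
    intro w hw
    rw [← Complex.re_add_im w, Complex.exp_add, ← Complex.ofReal_exp]
    exact real_mul_mem_openSector (exp_mem_openSector hw (hw.trans_le hα)) (Real.exp_pos _)
  have hFd : ∀ w : ℂ, |w.im| < α → DifferentiableAt ℂ F w := by
    intro w hw
    have h1 := (hf.differentiableAt ((isOpen_openSector hα).mem_nhds (hmem w hw))).comp w
      Complex.differentiableAt_exp
    have h2 : DifferentiableAt ℂ (fun w => Complex.exp (-(μ * Complex.exp w))) w := by fun_prop
    exact Complex.differentiableAt_exp.smul (h2.smul h1)
  -- The factor `e^s` from `dz` gives decay at `-∞`, and `e^{-δ e^s}` gives it at `+∞`.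
  have hFb : ∀ s : ℝ, ∀ y ∈ uIcc 0 θ, ‖F (s + y * Complex.I)‖
      ≤ Real.exp s * (M * Real.exp (-δ * Real.exp s)) := by
    intro s y hy'
    have e1 : Complex.exp (s + y * Complex.I) = Real.exp s * Complex.exp (y * Complex.I) := by
      rw [Complex.exp_add, Complex.ofReal_exp]
    have h1 := hM _ (hmem (s + y * Complex.I) (by simpa using hy y hy'))
    have h2 : (-(μ * Complex.exp (s + y * Complex.I))).re ≤ -δ * Real.exp s := by
      have : μ * Complex.exp (s + y * Complex.I) = Real.exp s * (μ * Complex.exp (y * Complex.I)) := by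
        rw [e1]; ring
      rw [this, Complex.neg_re, Complex.re_ofReal_mul]
      nlinarith [hμ y hy', Real.exp_pos s]
    simp only [F, norm_smul, Complex.norm_exp]
    have h3 : (s + y * Complex.I : ℂ).re = s := by simp
    rw [h3, mul_comm M]
    gcongr
  have hcont : ∀ y : ℝ, |y| < α → Continuous fun s : ℝ => F (s + y * Complex.I) := by
    intro y hy
    refine continuous_iff_continuousAt.2 fun s => ?_
    have h1 : ContinuousAt F (s + y * Complex.I) := (hFd _ (by simpa using hy)).continuousAt
    exact ContinuousAt.comp (f := fun s : ℝ => (s + y * Complex.I : ℂ)) h1 (by fun_prop)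
  have hgi : Integrable fun s : ℝ => Real.exp s * (M * Real.exp (-δ * Real.exp s)) :=
    (integrable_exp_smul_comp_exp fun u => M * Real.exp (-δ * u)).2
      ((integrableOn_exp_mul_Ioi (by linarith) 0).const_mul M)
  have hint : ∀ y ∈ uIcc 0 θ, Integrable fun s : ℝ => F (s + y * Complex.I) := fun y hy' =>
    hgi.mono' (hcont y (hy y hy')).aestronglyMeasurable (ae_of_all _ fun s => hFb s y hy')
  have htop : Tendsto (fun s : ℝ => Real.exp s * (M * Real.exp (-δ * Real.exp s))) atTop (𝓝 0) := by
    have h1 : Tendsto (fun u : ℝ => u * Real.exp (-δ * u)) atTop (𝓝 0) := by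
      simpa using tendsto_rpow_mul_exp_neg_mul_atTop_nhds_zero 1 δ hδ
    simpa [mul_left_comm] using (h1.comp Real.tendsto_exp_atTop).const_mul M
  have hbot : Tendsto (fun s : ℝ => Real.exp s * (M * Real.exp (-δ * Real.exp s))) atBot (𝓝 0) := by
    have h1 : Continuous fun u : ℝ => u * (M * Real.exp (-δ * u)) := by fun_prop
    have := (h1.tendsto 0).comp Real.tendsto_exp_atBot
    simpa [Function.comp_def] using this
  have main := integral_horizontal_eq (F := F) (a := 0) (b := θ)
    (fun w hw => (hFd w (hy _ hw)).differentiableWithinAt) hFb htop hbot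
    (hint 0 left_mem_uIcc) (hint θ right_mem_uIcc)
  rw [← integral_exp_smul_comp_exp, ← integral_exp_smul_comp_exp]
  convert main using 3 with s s
  · simp only [F]
    simp [← Complex.coe_smul]
  · simp only [F, Complex.exp_add, smul_smul, ← Complex.coe_smul, ← Complex.ofReal_exp]
    congr 1
    ring

theorem integral_inv_sq_add_two_pi_mul_sq {c : ℝ} (hc : 0 < c) :
    Integrable (fun ξ : ℝ => (c ^ 2 + (2 * π * ξ) ^ 2)⁻¹) ∧
      ∫ ξ : ℝ, (c ^ 2 + (2 * π * ξ) ^ 2)⁻¹ = 1 / (2 * c) := by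
  have hk : (2 * π / c) ≠ 0 := by positivity
  have e : (fun ξ : ℝ => (c ^ 2 + (2 * π * ξ) ^ 2)⁻¹) =
      fun ξ => (c ^ 2)⁻¹ * (1 + ((2 * π / c) * ξ) ^ 2)⁻¹ := by
    ext ξ
    rw [← mul_inv]
    congr 1
    field_simp
  rw [e]
  constructor
  · exact (integrable_inv_one_add_sq.comp_mul_left' hk).const_mul _
  · rw [integral_const_mul, Measure.integral_comp_mul_left (fun x => (1 + x ^ 2)⁻¹),
      integral_univ_inv_one_add_sq, abs_of_pos (by positivity), smul_eq_mul]
    field_simp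

/-- A bound for a function from a bound for the derivative of its Laplace transform. -/
theorem norm_le_of_laplace_bound [NormedSpace ℂ E] [CompleteSpace E] {S : ℝ → E} {C B : ℝ}
    (hS : ContinuousOn S (Ioi 0)) (hC : ∀ t, 0 < t → ‖S t‖ ≤ C)
    (hB : ∀ μ : ℂ, 0 < μ.re →
      ‖∫ t in Ioi (0 : ℝ), Complex.exp (-(μ * t)) • ((t : ℂ) • S t)‖ ≤ B / ‖μ‖ ^ 2)
    {t : ℝ} (ht : 0 < t) : ‖S t‖ ≤ Real.exp 1 / 2 * B := by
  -- With abscissa `1 / t` the factor `e^{ct}` is `e`, and the inversion integral `B / (2c) = B t /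
  -- 2` cancels the weight `t`.
  set c : ℝ := t⁻¹
  have hc : 0 < c := inv_pos.2 ht
  have hC0 : 0 ≤ C := (norm_nonneg _).trans (hC t ht)
  -- Its Fourier transform is the Laplace transform of `t S(t)` on the line `Re = c`. The weight `t`
  -- is what makes the transform decay quadratically, hence integrable.
  set f : ℝ → E := (Ioi (0 : ℝ)).indicator
    fun s => Complex.exp (-((c : ℂ) * s)) • ((s : ℂ) • S s)
  have hbound : ∀ s : ℝ, 0 < s → ‖Complex.exp (-((c : ℂ) * s)) • ((s : ℂ) • S s)‖
      ≤ C * (s * Real.exp (-c * s)) := by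
    intro s hs
    have h1 : (-((c : ℂ) * s)).re = -c * s := by simp
    rw [norm_smul, norm_smul, Complex.norm_exp, h1, Complex.norm_real, Real.norm_of_nonneg hs.le]
    have := hC s hs
    calc Real.exp (-c * s) * (s * ‖S s‖) ≤ Real.exp (-c * s) * (s * C) := by gcongr
      _ = _ := by ring
  have hgc : ContinuousOn (fun s : ℝ => Complex.exp (-((c : ℂ) * s)) • ((s : ℂ) • S s)) (Ioi 0) := by
    refine ContinuousOn.smul (by fun_prop) (ContinuousOn.smul (by fun_prop) hS)
  have hfi : Integrable f := by
    rw [integrable_indicator_iff measurableSet_Ioi]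
    have h1 : IntegrableOn (fun s : ℝ => C * (s * Real.exp (-c * s))) (Ioi 0) := by
      have := (integrableOn_rpow_mul_exp_neg_mul_rpow (p := 1) (s := 1) (b := c) (by norm_num)
        (by norm_num) hc).const_mul C
      simpa [IntegrableOn] using this
    refine Integrable.mono' h1 (hgc.aestronglyMeasurable measurableSet_Ioi) ?_
    filter_upwards [ae_restrict_mem measurableSet_Ioi] with s hs using hbound s hs
  have hF : ∀ ξ : ℝ, ‖FourierTransform.fourier f ξ‖ ≤ B * (c ^ 2 + (2 * π * ξ) ^ 2)⁻¹ := by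
    intro ξ
    have e : FourierTransform.fourier f ξ = ∫ s in Ioi (0 : ℝ),
        Complex.exp (-((c + 2 * π * ξ * Complex.I) * s)) • ((s : ℂ) • S s) := by
      rw [Real.fourier_eq', ← integral_indicator measurableSet_Ioi]
      congr 1
      ext s
      by_cases hs : s ∈ Ioi (0 : ℝ)
      · simp only [f, indicator_of_mem hs, smul_smul]
        rw [← mul_assoc, ← Complex.exp_add]
        congr 3
        simp
        ring
      · simp only [f, indicator_of_notMem hs, smul_zero]
    rw [e]
    refine (hB _ (by simpa using hc)).trans_eq ?_
    rw [div_eq_mul_inv, Complex.sq_norm, Complex.normSq_apply]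
    simp [pow_two]
  have hI := integral_inv_sq_add_two_pi_mul_sq hc
  have hmeas : AEStronglyMeasurable (FourierTransform.fourier f) volume :=
    (VectorFourier.fourierIntegral_continuous Real.continuous_fourierChar
      (by exact continuous_inner) hfi).aestronglyMeasurable
  have hFi : Integrable (FourierTransform.fourier f) :=
    (hI.1.const_mul B).mono' hmeas (ae_of_all _ hF)
  have hcont : ContinuousAt f t := by
    refine (hgc.continuousAt (Ioi_mem_nhds ht)).congr ?_
    filter_upwards [Ioi_mem_nhds ht] with s hs
    simp only [f, indicator_of_mem hs]
  have inv := hfi.fourierInv_fourier_eq hFi hcont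
  have hft : ‖f t‖ ≤ B * (1 / (2 * c)) := by
    rw [← inv, Real.fourierInv_eq', ← hI.2, ← integral_const_mul]
    refine norm_integral_le_of_norm_le (hI.1.const_mul B) (ae_of_all _ fun ξ => ?_)
    rw [norm_smul, Complex.norm_exp_ofReal_mul_I, one_mul]
    exact hF ξ
  have hft2 : ‖f t‖ = Real.exp (-1) * (t * ‖S t‖) := by
    have h1 : (-((c : ℂ) * t)).re = -1 := by simp [c, ht.ne']
    simp only [f, indicator_of_mem (show t ∈ Ioi (0 : ℝ) from ht)]
    rw [norm_smul, norm_smul, Complex.norm_exp, h1, Complex.norm_real, Real.norm_of_nonneg ht.le]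
  rw [hft2] at hft
  have h5 : B * (1 / (2 * c)) = t * (B / 2) := by simp only [c]; field_simp
  rw [h5, mul_left_comm] at hft
  have h6 := le_of_mul_le_mul_left hft ht
  calc ‖S t‖ = Real.exp 1 * (Real.exp (-1) * ‖S t‖) := by
        rw [← mul_assoc, ← Real.exp_add]; simp
    _ ≤ Real.exp 1 * (B / 2) := by gcongr
    _ = _ := by ring

end Analysis

/-! ### Laplace transforms of bounded semigroups. -/

section Laplace

variable {𝔸 : Type*} [NormedRing 𝔸] [NormedAlgebra ℂ 𝔸]

/-- The Laplace transform of `S : (0, ∞) → 𝔸`. -/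
noncomputable def laplace {E : Type*} [NormedAddCommGroup E] [NormedSpace ℂ E] (S : ℝ → E)
    (μ : ℂ) : E :=
  ∫ t in Ioi (0 : ℝ), Complex.exp (-(μ * t)) • S t

theorem norm_exp_neg_mul_smul_le {E : Type*} [NormedAddCommGroup E] [NormedSpace ℂ E] {S : ℝ → E}
    {M : ℝ} (hM : ∀ t, 0 < t → ‖S t‖ ≤ M) (μ : ℂ) {t : ℝ} (ht : 0 < t) :
    ‖Complex.exp (-(μ * t)) • S t‖ ≤ M * Real.exp (-μ.re * t) := by
  have h1 : (-(μ * t)).re = -μ.re * t := by simp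
  rw [norm_smul, Complex.norm_exp, h1, mul_comm]
  exact mul_le_mul_of_nonneg_right (hM t ht) (Real.exp_pos _).le

theorem integrableOn_laplace {E : Type*} [NormedAddCommGroup E] [NormedSpace ℂ E] {S : ℝ → E}
    {M : ℝ} (hS : ContinuousOn S (Ioi 0)) (hM : ∀ t, 0 < t → ‖S t‖ ≤ M) {μ : ℂ} (hμ : 0 < μ.re) :
    IntegrableOn (fun t : ℝ => Complex.exp (-(μ * t)) • S t) (Ioi 0) := by
  refine Integrable.mono' ((integrableOn_exp_mul_Ioi (a := -μ.re) (by linarith) 0).const_mul M)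
    (ContinuousOn.aestronglyMeasurable (ContinuousOn.smul (by fun_prop) hS) measurableSet_Ioi) ?_
  filter_upwards [ae_restrict_mem measurableSet_Ioi] with t ht using
    norm_exp_neg_mul_smul_le hM μ ht

theorem norm_laplace_le {E : Type*} [NormedAddCommGroup E] [NormedSpace ℂ E] {S : ℝ → E}
    {M : ℝ} (hM : ∀ t, 0 < t → ‖S t‖ ≤ M) {μ : ℂ} (hμ : 0 < μ.re) :
    ‖laplace S μ‖ ≤ M / μ.re := by
  have h1 : ∫ t in Ioi (0 : ℝ), M * Real.exp (-μ.re * t) = M / μ.re := by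
    rw [integral_const_mul, integral_exp_mul_Ioi (by linarith)]
    simp [div_eq_mul_inv]
  rw [← h1]
  refine norm_integral_le_of_norm_le
    ((integrableOn_exp_mul_Ioi (a := -μ.re) (by linarith) 0).const_mul M) ?_
  filter_upwards [ae_restrict_mem measurableSet_Ioi] with t ht using
    norm_exp_neg_mul_smul_le hM μ ht

theorem tendsto_exp_neg_mul_smul_atTop {E : Type*} [NormedAddCommGroup E] [NormedSpace ℂ E]
    {S : ℝ → E} {M : ℝ} (hM : ∀ t, 0 < t → ‖S t‖ ≤ M) {μ : ℂ} (hμ : 0 < μ.re) :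
    Tendsto (fun t : ℝ => Complex.exp (-(μ * t)) • S t) atTop (𝓝 0) := by
  have h1 : Tendsto (fun t : ℝ => M * Real.exp (-μ.re * t)) atTop (𝓝 0) := by
    have := (Real.tendsto_exp_neg_atTop_nhds_zero.comp
      (tendsto_id.const_mul_atTop hμ)).const_mul M
    simpa [Function.comp_def] using this
  refine squeeze_zero_norm' ?_ h1
  filter_upwards [eventually_gt_atTop 0] with t ht using norm_exp_neg_mul_smul_le hM μ ht

/-- The Laplace transform of a bounded semigroup satisfies the resolvent identity. -/
theorem laplace_sub_laplace [CompleteSpace 𝔸] {S : ℝ → 𝔸} {M : ℝ} (hS : ContinuousOn S (Ioi 0))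
    (hM : ∀ t, 0 < t → ‖S t‖ ≤ M) (hadd : ∀ s t, 0 < s → 0 < t → S (s + t) = S s * S t)
    {μ ν : ℂ} (hμ : 0 < μ.re) (hν : 0 < ν.re) :
    laplace S μ - laplace S ν = (ν - μ) • (laplace S μ * laplace S ν) := by
  set Q := laplace S ν
  set h : ℝ → 𝔸 := fun r => Complex.exp (-(ν * r)) • S r
  have hhi : IntegrableOn h (Ioi 0) := integrableOn_laplace hS hM hν
  have hhc : ContinuousOn h (Ioi 0) := ContinuousOn.smul (by fun_prop) hS
  have hM0 : 0 ≤ M := (norm_nonneg _).trans (hM 1 one_pos)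
  have hhb : ∀ r, 0 < r → ‖h r‖ ≤ M := fun r hr =>
    (norm_exp_neg_mul_smul_le hM ν hr).trans (by
      have : Real.exp (-ν.re * r) ≤ 1 := Real.exp_le_one_iff.2 (by nlinarith)
      nlinarith)
  -- The tail of the integral from `t` on. By the semigroup law `S t * Q = e^{νt} K t`, so `S t * Q`
  -- is differentiable although `S` is only assumed continuous.
  set K : ℝ → 𝔸 := fun t => Q - ∫ r in (0 : ℝ)..t, h r
  have hII : ∀ t, 0 < t → IntervalIntegrable h volume 0 t := fun t ht =>
    (intervalIntegrable_iff_integrableOn_Ioc_of_le ht.le).2 (hhi.mono_set Ioc_subset_Ioi_self)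
  have hK : ∀ t, 0 < t → S t * Q = Complex.exp (ν * t) • K t := by
    intro t ht
    have e1 : ∀ s ∈ Ioi (0 : ℝ), S t * (Complex.exp (-(ν * s)) • S s)
        = Complex.exp (ν * t) • h (s + t) := by
      intro s hs
      simp only [h]
      rw [mul_smul_comm, add_comm s t, hadd t s ht hs, smul_smul, ← Complex.exp_add]
      congr 2
      push_cast
      ring
    have e2 : ∫ s in Ioi (0 : ℝ), h (s + t) = ∫ r in Ioi t, h r := by
      have := (measurePreserving_add_right volume t).setIntegral_preimage_emb
        (measurableEmbedding_addRight t) h (Ioi t)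
      rw [← this]
      congr 2
      ext s; simp
    have e3 : K t = ∫ r in Ioi t, h r := by
      simp only [K, Q, laplace]
      rw [sub_eq_iff_eq_add', intervalIntegral.integral_of_le ht.le,
        ← setIntegral_union Ioc_disjoint_Ioi_same measurableSet_Ioi
        (hhi.mono_set Ioc_subset_Ioi_self) (hhi.mono_set (Ioi_subset_Ioi ht.le)),
        Ioc_union_Ioi_eq_Ioi ht.le]
    rw [e3, ← e2, ← integral_smul, ← setIntegral_congr_fun measurableSet_Ioi e1]
    exact ((ContinuousLinearMap.mul ℂ 𝔸 (S t)).integral_comp_comm hhi).symm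
  have hKd : ∀ t, 0 < t → HasDerivAt K (-h t) t := fun t ht =>
    (intervalIntegral.integral_hasDerivAt_right (hII t ht)
      (hhc.stronglyMeasurableAtFilter isOpen_Ioi t ht)
      (hhc.continuousAt (Ioi_mem_nhds ht))).const_sub Q
  have hK0 : Tendsto K (𝓝[>] 0) (𝓝 Q) := by
    have : Tendsto (fun t => ∫ r in (0 : ℝ)..t, h r) (𝓝[>] 0) (𝓝 0) := by
      refine squeeze_zero_norm' (a := fun t => M * |t - 0|) ?_ ?_
      · filter_upwards [self_mem_nhdsWithin] with t ht
        refine intervalIntegral.norm_integral_le_of_norm_le_const fun r hr => hhb r ?_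
        rw [uIoc_of_le (le_of_lt ht)] at hr
        exact hr.1
      · have hc : Continuous fun t : ℝ => M * |t - 0| := by fun_prop
        simpa using (hc.tendsto 0).mono_left nhdsWithin_le_nhds
    simpa using this.const_sub Q
  -- `G` runs from `Q` at `0` to `0` at infinity; integrating its derivative is the resolvent
  -- identity.
  set G : ℝ → 𝔸 := fun t => Complex.exp (-(μ * t)) • (S t * Q)
  have hG : ∀ t, 0 < t → G t = Complex.exp ((ν - μ) * t) • K t := by
    intro t ht
    simp only [G]
    rw [hK t ht, smul_smul, ← Complex.exp_add]
    congr 2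
    ring
  have hGd : ∀ t : ℝ, 0 < t → HasDerivAt G
      ((ν - μ) • (Complex.exp (-(μ * t)) • S t * Q) - Complex.exp (-(μ * t)) • S t) t := by
    intro t ht
    have h1 : HasDerivAt (fun t : ℝ => Complex.exp ((ν - μ) * t))
        (Complex.exp ((ν - μ) * t) * (ν - μ)) t := by
      have := ((hasDerivAt_id (t : ℂ)).const_mul (ν - μ)).cexp.comp_ofReal
      simpa using this
    have h2 := h1.smul (hKd t ht)
    have h3 := h2.congr_of_eventuallyEq (f₁ := G) (by
      filter_upwards [Ioi_mem_nhds ht] with s hs using hG s hs)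
    have hval : (ν - μ) • (Complex.exp (-(μ * t)) • S t * Q) - Complex.exp (-(μ * t)) • S t =
        Complex.exp ((ν - μ) * t) • -h t + (Complex.exp ((ν - μ) * t) * (ν - μ)) • K t := by
      have h4 := hG t ht
      simp only [G] at h4
      rw [smul_mul_assoc, h4]
      have e : Complex.exp (-(μ * t)) = Complex.exp ((ν - μ) * t) * Complex.exp (-(ν * t)) := by
        rw [← Complex.exp_add]; congr 1; ring
      rw [e]
      simp only [h]
      module
    rw [hval]
    exact h3
  have hSQ : ∀ t, 0 < t → ‖S t * Q‖ ≤ M * ‖Q‖ := fun t ht =>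
    (norm_mul_le _ _).trans (mul_le_mul_of_nonneg_right (hM t ht) (norm_nonneg _))
  have hGtop : Tendsto G atTop (𝓝 0) := tendsto_exp_neg_mul_smul_atTop hSQ hμ
  have hG0 : Tendsto G (𝓝[>] 0) (𝓝 Q) := by
    have hc : Continuous fun t : ℝ => Complex.exp ((ν - μ) * t) := by fun_prop
    have h1 := ((hc.tendsto 0).mono_left nhdsWithin_le_nhds).smul hK0
    simp only [Complex.ofReal_zero, mul_zero, Complex.exp_zero, one_smul] at h1
    refine h1.congr' ?_
    filter_upwards [self_mem_nhdsWithin] with t ht using (hG t ht).symm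
  have hi1 : IntegrableOn (fun t : ℝ => Complex.exp (-(μ * t)) • S t) (Ioi 0) :=
    integrableOn_laplace hS hM hμ
  have hi2 : IntegrableOn (fun t : ℝ => Complex.exp (-(μ * t)) • S t * Q) (Ioi 0) :=
    Integrable.mul_const hi1 Q
  have hi3 : IntegrableOn (fun t : ℝ => (ν - μ) • (Complex.exp (-(μ * t)) • S t * Q)) (Ioi 0) :=
    Integrable.smul (ν - μ) hi2
  have fin := integral_Ioi_zero_of_tendsto hGd (hi3.sub hi1) hG0 hGtop
  have e5 : ∫ t in Ioi (0 : ℝ), Complex.exp (-(μ * t)) • S t * Q = laplace S μ * Q :=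
    ((ContinuousLinearMap.mul ℂ 𝔸).flip Q).integral_comp_comm hi1
  rw [integral_sub hi3 hi1, integral_smul, e5] at fin
  change (ν - μ) • (laplace S μ * Q) - laplace S μ = 0 - Q at fin
  rw [← sub_eq_zero] at fin ⊢
  rw [← neg_eq_zero, ← fin]
  abel

end Laplace

/-! ### Part (b): the generator of a bounded holomorphic semigroup. -/

section Generation

variable {X : Type*} [NormedAddCommGroup X] [NormedSpace ℂ X]

/-- A generator of a bounded function is determined by its resolvent at `1`. -/
theorem IsGenerator.hasResolvent_one [CompleteSpace X] {A : LinRel X} {S : ℝ → X →L[ℂ] X} {M : ℝ}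
    (hS : ContinuousOn S (Ioi 0)) (hM : ∀ t, 0 < t → ‖S t‖ ≤ M) (h : IsGenerator A S) :
    A.HasResolvent 1 (laplace S 1) := by
  have h1 : (1 : ℂ) ∈ A.resolventSet := by simpa using h.mem_resolventSet 1 one_pos
  have h2 := LinRel.hasResolvent_resolvent h1
  convert h2 using 1
  ext x
  have h3 := h.resolvent_eq 1 one_pos x
  rw [Complex.ofReal_one] at h3
  rw [h3, laplace, ContinuousLinearMap.integral_apply (integrableOn_laplace hS hM (by simp))]
  congr 1
  ext t
  simp [← Complex.coe_smul]

theorem isGenerator_of_hasResolvent [CompleteSpace X] {A : LinRel X} {S : ℝ → X →L[ℂ] X} {M : ℝ}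
    (hS : ContinuousOn S (Ioi 0)) (hM : ∀ t, 0 < t → ‖S t‖ ≤ M)
    (h : ∀ μ : ℝ, 0 < μ → A.HasResolvent μ (laplace S μ)) : IsGenerator A S := by
  have e : ∀ (μ : ℝ) (x : X), (fun t : ℝ => (Complex.exp (-((μ : ℂ) * t)) • S t) x)
      = fun t : ℝ => Real.exp (-(μ * t)) • S t x := by
    intro μ x
    ext t
    simp [← Complex.coe_smul]
  refine ⟨(h 1 one_pos).isClosed, fun μ hμ => (h μ hμ).mem_resolventSet, fun μ hμ x => ?_,
    fun μ hμ x => ?_⟩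
  · rw [← e]
    exact (integrableOn_laplace hS hM (by simpa using hμ)).apply_continuousLinearMap x
  · rw [(h μ hμ).resolvent_eq, ← e, laplace,
      ContinuousLinearMap.integral_apply (integrableOn_laplace hS hM (by simpa using hμ))]

variable {α M : ℝ} {T : ℂ → X →L[ℂ] X}

theorem real_mul_exp_mem_openSector {θ : ℝ} (hα : α ≤ π / 2) (hθ : |θ| < α) {t : ℝ} (ht : 0 < t) :
    (t : ℂ) * Complex.exp (θ * Complex.I) ∈ openSector α :=
  real_mul_mem_openSector (exp_mem_openSector hθ (by linarith [Real.pi_pos])) ht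

theorem IsHolomorphicSemigroup.continuousOn_ray (hα : α ≤ π / 2) (hT : IsHolomorphicSemigroup α T)
    {θ : ℝ} (hθ : |θ| < α) :
    ContinuousOn (fun t : ℝ => T (t * Complex.exp (θ * Complex.I))) (Ioi 0) :=
  hT.differentiableOn.continuousOn.comp (by fun_prop) fun _ ht =>
    real_mul_exp_mem_openSector hα hθ ht

/-- The resolvent of a generator on a rotated half plane is the Laplace transform along a ray. -/
theorem IsHolomorphicSemigroup.hasResolvent_ray [CompleteSpace X] (hα : α ≤ π / 2)
    (hT : IsHolomorphicSemigroup α T) (hM : ∀ z ∈ openSector α, ‖T z‖ ≤ M) {A : LinRel X}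
    (hA : A.HasResolvent 1 (laplace (fun t : ℝ => T t) 1)) {θ : ℝ} (hθ : |θ| < α) {μ : ℂ}
    (hμ : 0 < (μ * Complex.exp (θ * Complex.I)).re) :
    A.HasResolvent μ (Complex.exp (θ * Complex.I) •
      laplace (fun t : ℝ => T (t * Complex.exp (θ * Complex.I)))
        (μ * Complex.exp (θ * Complex.I))) := by
  have hα0 : 0 < α := (abs_nonneg θ).trans_lt hθ
  have hπ := Real.pi_pos
  have hid : ∀ φ : ℝ, |φ| < α → ∀ μ ν : ℂ, 0 < μ.re → 0 < ν.re →
      laplace (fun t : ℝ => T (t * Complex.exp (φ * Complex.I))) μ -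
        laplace (fun t : ℝ => T (t * Complex.exp (φ * Complex.I))) ν =
      (ν - μ) • (laplace (fun t : ℝ => T (t * Complex.exp (φ * Complex.I))) μ *
        laplace (fun t : ℝ => T (t * Complex.exp (φ * Complex.I))) ν) := by
    intro φ hφ μ ν hμ hν
    refine laplace_sub_laplace (M := M) (hT.continuousOn_ray hα hφ)
      (fun t ht => hM _ (real_mul_exp_mem_openSector hα hφ ht)) (fun s t hs ht => ?_) hμ hν
    have := hT.map_add _ (real_mul_exp_mem_openSector hα hφ hs) _
      (real_mul_exp_mem_openSector hα hφ ht)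
    rw [← add_mul] at this
    push_cast
    exact this
  -- On a fixed ray, being the resolvent at one point of the half plane propagates to every other
  -- point of it.
  have hid' : ∀ φ : ℝ, |φ| < α → ∀ μ ν : ℂ, 0 < (μ * Complex.exp (φ * Complex.I)).re →
      0 < (ν * Complex.exp (φ * Complex.I)).re → ∀ {B : LinRel X},
      B.HasResolvent μ (Complex.exp (φ * Complex.I) •
        laplace (fun t : ℝ => T (t * Complex.exp (φ * Complex.I)))
        (μ * Complex.exp (φ * Complex.I))) →
      B.HasResolvent ν (Complex.exp (φ * Complex.I) •
        laplace (fun t : ℝ => T (t * Complex.exp (φ * Complex.I)))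
        (ν * Complex.exp (φ * Complex.I))) := by
    intro φ hφ μ ν hμ hν B hB
    have h1 := hid φ hφ _ _ hμ hν
    have h2 := hid φ hφ _ _ hν hμ
    refine hB.of_resolvent_identity ?_ ?_
    · rw [← neg_sub, ← smul_sub, h2, smul_mul_smul_comm, smul_smul, smul_smul, ← neg_smul]
      congr 1
      ring
    · rw [← smul_sub, h1, smul_mul_smul_comm, smul_smul, smul_smul]
      congr 1
      ring
  -- A bridge between the rays of angles `0` and `θ`: since `|θ| < π / 2`, the point `e^{-iθ/2}`
  -- lies in the half planes of all intermediate rays, with real part at least `cos (θ / 2)`.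
  set μ₀ : ℂ := Complex.exp ((-(θ / 2) : ℝ) * Complex.I)
  have hre : ∀ y : ℝ, (μ₀ * Complex.exp (y * Complex.I)).re = Real.cos (y - θ / 2) := by
    intro y
    rw [← Complex.exp_add, ← add_mul, ← Complex.ofReal_add, Complex.exp_ofReal_mul_I_re]
    congr 1; ring
  have hcos : 0 < Real.cos (θ / 2) := by
    have := abs_lt.1 hθ
    exact Real.cos_pos_of_mem_Ioo ⟨by linarith, by linarith⟩
  have h0 : A.HasResolvent μ₀ (laplace (fun t : ℝ => T t) μ₀) := by
    have := hid' 0 (by simpa using hα0) 1 μ₀ (by simp)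
      (by rw [hre, zero_sub, Real.cos_neg]; exact hcos) (B := A) (by simpa using hA)
    simpa using this
  have hrot := laplace_rotate (f := T) (μ := μ₀) (θ := θ) (by linarith) hT.differentiableOn hM hθ
    hcos (fun y hy => by
      rw [hre]
      have h1 : |y - θ / 2| ≤ |θ / 2| := by
        rcases le_total 0 θ with h | h
        · rw [uIcc_of_le h] at hy
          rw [abs_of_nonneg (by linarith : 0 ≤ θ / 2)]
          exact abs_le.2 ⟨by linarith [hy.1], by linarith [hy.2]⟩
        · rw [uIcc_of_ge h] at hy
          rw [abs_of_nonpos (by linarith : θ / 2 ≤ 0)]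
          exact abs_le.2 ⟨by linarith [hy.1], by linarith [hy.2]⟩
      have h2 : |θ / 2| ≤ π := by
        rw [abs_div, abs_two]; linarith
      rw [← Real.cos_abs, ← Real.cos_abs (y - θ / 2)]
      exact Real.cos_le_cos_of_nonneg_of_le_pi (abs_nonneg _) h2 h1)
  have hrot' : laplace (fun t : ℝ => T t) μ₀ = Complex.exp (θ * Complex.I) •
      laplace (fun t : ℝ => T (t * Complex.exp (θ * Complex.I)))
        (μ₀ * Complex.exp (θ * Complex.I)) := by
    rw [laplace, hrot, laplace, ← integral_smul]
    congr 1
    ext1 t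
    rw [smul_comm]
    congr 3
    ring
  rw [hrot'] at h0
  exact hid' θ hθ μ₀ μ (by rw [hre]; ring_nf; ring_nf at hcos; exact hcos) hμ h0

/-- The real part is `|μ| cos (arg μ + θ)`, so it suffices to turn `μ` until its argument is at most
`π / 2 - ε` in modulus. The required turn, if any, is `|arg μ| - (π / 2 - ε) < α`. -/
theorem exists_rotation {ε : ℝ} (hα₀ : 0 < α) (hε : 0 < ε)
    (hε' : ε < π / 2) {μ : ℂ} (hμ : μ ∈ openSector (α + π / 2 - ε)) :
    ∃ θ : ℝ, |θ| < α ∧ ‖μ‖ * Real.sin ε ≤ (μ * Complex.exp (θ * Complex.I)).re := by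
  have key : ∀ θ : ℝ, |μ.arg + θ| ≤ π / 2 - ε →
      ‖μ‖ * Real.sin ε ≤ (μ * Complex.exp (θ * Complex.I)).re := by
    intro θ h
    have e : (μ * Complex.exp (θ * Complex.I)).re = ‖μ‖ * Real.cos (μ.arg + θ) := by
      nth_rewrite 1 [← norm_mul_exp_arg (z := μ)]
      rw [mul_assoc, ← Complex.exp_add, ← add_mul, ← Complex.ofReal_add, Complex.re_ofReal_mul,
        Complex.exp_ofReal_mul_I_re]
    rw [e, ← Real.cos_pi_div_two_sub, ← Real.cos_abs (μ.arg + θ)]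
    refine mul_le_mul_of_nonneg_left ?_ (norm_nonneg _)
    exact Real.cos_le_cos_of_nonneg_of_le_pi (abs_nonneg _) (by linarith) h
  have h2 := abs_lt.1 hμ.2
  rcases le_or_gt |μ.arg| (π / 2 - ε) with h | h
  · exact ⟨0, by simpa using hα₀, key 0 (by simpa using h)⟩
  · rcases le_total 0 μ.arg with h0 | h0
    · rw [abs_of_nonneg h0] at h
      refine ⟨π / 2 - ε - μ.arg, abs_lt.2 ⟨by linarith, by linarith⟩, key _ ?_⟩
      rw [add_sub_cancel, abs_of_nonneg (by linarith)]
    · rw [abs_of_nonpos h0] at h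
      refine ⟨-(π / 2 - ε) - μ.arg, abs_lt.2 ⟨by linarith, by linarith⟩, key _ ?_⟩
      rw [add_sub_cancel, abs_neg, abs_of_nonneg (by linarith)]

/-- Generators of bounded holomorphic semigroups are sectorial. -/
theorem IsHolomorphicSemigroup.generator [CompleteSpace X] (hα₀ : 0 < α) (hα : α ≤ π / 2)
    (hT : IsHolomorphicSemigroup α T) (hM : ∀ z ∈ openSector α, ‖T z‖ ≤ M) :
    (∃! A : LinRel X, IsGenerator A (fun t : ℝ => T (t : ℂ))) ∧
      ∀ A : LinRel X, IsGenerator A (fun t : ℝ => T (t : ℂ)) →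
        openSector (α + π / 2) ⊆ A.resolventSet ∧
        ∀ ε : ℝ, 0 < ε → ε < π / 2 → ∀ μ ∈ openSector (α + π / 2 - ε),
          ‖μ • A.resolvent μ‖ ≤ M * (1 / Real.sin ε) := by
  have hc : ContinuousOn (fun t : ℝ => T t) (Ioi 0) := by
    simpa using hT.continuousOn_ray hα (θ := 0) (by simpa using hα₀)
  have hb : ∀ t : ℝ, 0 < t → ‖T t‖ ≤ M := fun t ht => hM _ (ofReal_mem_openSector hα₀ ht)
  have hM0 : 0 ≤ M := (norm_nonneg _).trans (hb 1 one_pos)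
  -- Existence and uniqueness both rest on the Laplace transform at the single point `1`.
  refine ⟨⟨LinRel.ofResolvent 1 (laplace (fun t : ℝ => T t) 1), ?_, fun B hB =>
    (hB.hasResolvent_one hc hb).unique (LinRel.hasResolvent_ofResolvent _ _)⟩, fun A hA => ?_⟩
  · refine isGenerator_of_hasResolvent hc hb fun μ hμ => ?_
    have := hT.hasResolvent_ray hα hM (LinRel.hasResolvent_ofResolvent 1 _) (θ := 0) (μ := μ)
      (by simpa using hα₀) (by simpa using hμ)
    simpa using this
  · have hA1 := hA.hasResolvent_one hc hb
    have main : ∀ ε : ℝ, 0 < ε → ε < π / 2 → ∀ μ ∈ openSector (α + π / 2 - ε),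
        μ ∈ A.resolventSet ∧ ‖μ • A.resolvent μ‖ ≤ M * (1 / Real.sin ε) := by
      intro ε hε hε' μ hμ
      obtain ⟨θ, hθ, h⟩ := exists_rotation hα₀ hε hε' hμ
      have hs : 0 < Real.sin ε := Real.sin_pos_of_pos_of_lt_pi hε (by linarith [Real.pi_pos])
      have hn : 0 < ‖μ‖ := norm_pos_iff.2 hμ.1
      have hpos : 0 < (μ * Complex.exp (θ * Complex.I)).re := (mul_pos hn hs).trans_le h
      have hR := hT.hasResolvent_ray hα hM hA1 hθ hpos
      refine ⟨hR.mem_resolventSet, ?_⟩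
      have hl := norm_laplace_le (S := fun t : ℝ => T (t * Complex.exp (θ * Complex.I)))
        (fun t ht => hM _ (real_mul_exp_mem_openSector hα hθ ht)) hpos
      rw [hR.resolvent_eq, norm_smul, norm_smul, Complex.norm_exp_ofReal_mul_I, one_mul]
      calc _ ≤ ‖μ‖ * (M / (‖μ‖ * Real.sin ε)) := by gcongr; exact hl.trans (by gcongr)
        _ = _ := by field_simp
    refine ⟨fun μ hμ => ?_, fun ε hε hε' μ hμ => (main ε hε hε' μ hμ).2⟩
    have h1 := hμ.2
    set d := α + π / 2 - |μ.arg|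
    have hd : 0 < d := by simp only [d]; linarith
    -- Half the angular distance to the boundary keeps `μ` inside the smaller sector; the cap `π /
    -- 4` ensures `ε < π / 2`.
    have hε : 0 < min (d / 2) (π / 4) := lt_min (by linarith) (by positivity)
    refine (main (min (d / 2) (π / 4)) hε
      ((min_le_right _ _).trans_lt (by linarith [Real.pi_pos])) μ ⟨hμ.1, ?_⟩).1
    have := min_le_left (d / 2) (π / 4)
    simp only [d] at *
    linarith

end Generation

/-! ### The hyperbolic contour and its exact norms. -/

section Hyperbola

/-- The map `w ↦ cosh² (w / 2)`. It maps horizontal lines to hyperbolas, and strips to sectors. -/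
noncomputable def hyp (w : ℂ) : ℂ := (1 + Complex.cosh w) / 2

theorem hasDerivAt_hyp (w : ℂ) : HasDerivAt hyp (Complex.sinh w / 2) w :=
  ((Complex.hasDerivAt_cosh w).const_add 1).div_const 2

theorem continuous_hyp : Continuous hyp := by
  unfold hyp; fun_prop

theorem cosh_add_mul_I (s y : ℝ) : Complex.cosh (s + y * Complex.I) =
    (Real.cosh s * Real.cos y : ℝ) + (Real.sinh s * Real.sin y : ℝ) * Complex.I := by
  rw [Complex.cosh_add, Complex.cosh_mul_I, Complex.sinh_mul_I]
  push_cast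
  ring

theorem sinh_add_mul_I (s y : ℝ) : Complex.sinh (s + y * Complex.I) =
    (Real.sinh s * Real.cos y : ℝ) + (Real.cosh s * Real.sin y : ℝ) * Complex.I := by
  rw [Complex.sinh_add, Complex.cosh_mul_I, Complex.sinh_mul_I]
  push_cast
  ring

theorem hyp_eq_sq (w : ℂ) : hyp w = Complex.cosh (w / 2) * Complex.cosh (w / 2) := by
  have h1 := Complex.cosh_two_mul (w / 2)
  have h2 := Complex.cosh_sq_sub_sinh_sq (w / 2)
  rw [mul_div_cancel₀ w two_ne_zero] at h1
  rw [hyp, h1]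
  linear_combination (-1 / 2) * h2

/-- Since `hyp w` is a square, it suffices to place `cosh (w / 2)` in the sector of half the angle.
That angle is at most `π / 2`, so the linear criterion applies, and `|sinh p| < cosh p` reduces it
to `sin (γ / 2 - |q|) > 0`. -/
theorem hyp_mem_openSector {γ : ℝ} (hγ : γ ≤ π) {w : ℂ} (hw : |w.im| < γ) :
    hyp w ∈ openSector γ := by
  have hγ0 : 0 < γ := (abs_nonneg _).trans_lt hw
  rw [hyp_eq_sq]
  suffices h : Complex.cosh (w / 2) ∈ openSector (γ / 2) by
    have := mul_mem_openSector (by linarith) h h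
    rwa [add_halves] at this
  rw [mem_openSector_iff (by linarith) (by linarith)]
  have e : w / 2 = ((w.re / 2 : ℝ) : ℂ) + ((w.im / 2 : ℝ) : ℂ) * Complex.I := by
    nth_rewrite 1 [← Complex.re_add_im w]
    push_cast
    ring
  rw [e, cosh_add_mul_I]
  simp only [Complex.add_re, Complex.add_im, Complex.ofReal_re, Complex.ofReal_im,
    Complex.re_ofReal_mul, Complex.im_ofReal_mul, Complex.I_re, Complex.I_im, mul_zero, mul_one,
    add_zero, zero_add]
  set p := w.re / 2
  set q := w.im / 2
  have hq : |q| < γ / 2 := by simp only [q, abs_div, abs_two]; linarith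
  have h1 : |Real.sinh p| < Real.cosh p := by
    rw [Real.abs_sinh, ← Real.cosh_abs]; exact Real.sinh_lt_cosh _
  have h2 : 0 < Real.sin (γ / 2 - |q|) :=
    Real.sin_pos_of_pos_of_lt_pi (by linarith) (by linarith [abs_nonneg q])
  rw [Real.sin_sub, Real.cos_abs] at h2
  have h3 : |Real.sin q| = Real.sin |q| :=
    Real.abs_sin_eq_sin_abs_of_abs_le_pi (by linarith)
  have h4 : 0 ≤ Real.cos (γ / 2) := Real.cos_nonneg_of_mem_Icc ⟨by linarith, by linarith⟩
  rw [abs_mul, h3]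
  have h5 : 0 ≤ Real.sin |q| := h3 ▸ abs_nonneg _
  have h6 := Real.cosh_pos p
  calc |Real.sinh p| * Real.sin |q| * Real.cos (γ / 2)
      ≤ Real.cosh p * (Real.cos (γ / 2) * Real.sin |q|) := by
        rw [mul_assoc, mul_comm (Real.sin |q|)]; gcongr
    _ < Real.cosh p * (Real.sin (γ / 2) * Real.cos q) :=
        mul_lt_mul_of_pos_left (by linarith) h6
    _ = _ := by ring

theorem norm_one_add_cosh (s y : ℝ) :
    ‖1 + Complex.cosh (s + y * Complex.I)‖ = Real.cosh s + Real.cos y := by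
  have h0 : 0 ≤ Real.cosh s + Real.cos y := by
    linarith [Real.one_le_cosh s, Real.neg_one_le_cos y]
  rw [← sq_eq_sq₀ (norm_nonneg _) h0, Complex.sq_norm, Complex.normSq_apply, cosh_add_mul_I]
  simp only [Complex.add_re, Complex.add_im, Complex.ofReal_re, Complex.ofReal_im,
    Complex.re_ofReal_mul, Complex.im_ofReal_mul, Complex.I_re, Complex.I_im, mul_zero, mul_one,
    add_zero, zero_add, Complex.one_re, Complex.one_im]
  linear_combination (Real.sin y ^ 2) * (Real.sinh_sq s) +
    (Real.cosh s ^ 2 - 1) * (Real.sin_sq_add_cos_sq y)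

theorem norm_hyp (s y : ℝ) : ‖hyp (s + y * Complex.I)‖ = (Real.cosh s + Real.cos y) / 2 := by
  rw [hyp, norm_div, norm_one_add_cosh]
  simp

theorem norm_hyp_le (s y : ℝ) : ‖hyp (s + y * Complex.I)‖ ≤ Real.cosh s := by
  rw [norm_hyp]
  linarith [Real.one_le_cosh s, Real.cos_le_one y]

/-- From `c ≤ 0` and `cosh s ≥ 1` comes `c ≥ c cosh s`. A free `c` instead of `cos y` lets one
constant serve all lines of a strip. -/
theorem le_norm_hyp {s y c : ℝ} (hc : c ≤ 0) (h : c ≤ Real.cos y) :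
    (1 + c) / 2 * Real.cosh s ≤ ‖hyp (s + y * Complex.I)‖ := by
  rw [norm_hyp]
  nlinarith [Real.one_le_cosh s]

theorem norm_one_sub_hyp (s y : ℝ) :
    ‖1 - hyp (s + y * Complex.I)‖ = (Real.cosh s - Real.cos y) / 2 := by
  -- Shifting by `iπ` changes the sign of `cosh`.
  have h1 := norm_one_add_cosh s (y + π)
  have h2 : Complex.cosh (s + (y + π : ℝ) * Complex.I) = -Complex.cosh (s + y * Complex.I) := by
    rw [cosh_add_mul_I, cosh_add_mul_I, Real.cos_add_pi, Real.sin_add_pi]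
    push_cast
    ring
  rw [h2, Real.cos_add_pi] at h1
  have h3 : 1 - hyp (s + y * Complex.I) = (1 + -Complex.cosh (s + y * Complex.I)) / 2 := by
    rw [hyp]; ring
  rw [h3, norm_div, h1]
  simp [sub_eq_add_neg]

theorem norm_sinh_div_two_le (s y : ℝ) :
    ‖Complex.sinh (s + y * Complex.I) / 2‖ ≤ Real.cosh s := by
  have h : ‖Complex.sinh (s + y * Complex.I)‖ ≤ Real.cosh s := by
    rw [← sq_le_sq₀ (norm_nonneg _) (Real.cosh_pos s).le, Complex.sq_norm, Complex.normSq_apply,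
      sinh_add_mul_I]
    simp only [Complex.add_re, Complex.add_im, Complex.ofReal_re, Complex.ofReal_im,
      Complex.re_ofReal_mul, Complex.im_ofReal_mul, Complex.I_re, Complex.I_im, mul_zero, mul_one,
      add_zero, zero_add]
    nlinarith [Real.sinh_sq s, Real.sin_sq_add_cos_sq y, sq_nonneg (Real.cos y)]
  rw [norm_div]
  simp only [Complex.norm_ofNat]
  linarith [norm_nonneg (Complex.sinh (s + y * Complex.I))]

/-- Expanding `cosh`, the product is `z / 2 + (e^s / 4) z e^{iy} + (e^{-s} / 4) z e^{-iy}`, and each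
exponential term has real part at most `-κ e^{±s} / 4`. -/
theorem re_hyp_mul_le {y κ : ℝ} {z : ℂ} (h1 : (z * Complex.exp (y * Complex.I)).re ≤ -κ)
    (h2 : (z * Complex.exp ((-y : ℝ) * Complex.I)).re ≤ -κ) (s : ℝ) :
    (hyp (s + y * Complex.I) * z).re ≤ z.re / 2 - κ / 2 * Real.cosh s := by
  have e : hyp (s + y * Complex.I) * z = z / 2 + ((Real.exp s / 4 : ℝ) : ℂ) *
      (z * Complex.exp (y * Complex.I)) + ((Real.exp (-s) / 4 : ℝ) : ℂ) *
      (z * Complex.exp ((-y : ℝ) * Complex.I)) := by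
    rw [hyp, Complex.cosh]
    have e2 : Complex.exp (s + y * Complex.I) = Real.exp s * Complex.exp (y * Complex.I) := by
      rw [Complex.exp_add, Complex.ofReal_exp]
    have e3 : Complex.exp (-(s + y * Complex.I)) =
        Real.exp (-s) * Complex.exp ((-y : ℝ) * Complex.I) := by
      rw [Complex.ofReal_exp, ← Complex.exp_add]
      congr 1
      push_cast
      ring
    rw [e2, e3]
    push_cast
    ring
  have e4 : (z / 2).re = z.re / 2 := by simp
  rw [e, Complex.add_re, Complex.add_re, Complex.re_ofReal_mul, Complex.re_ofReal_mul, e4,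
    Real.cosh_eq]
  have := Real.exp_pos s
  have := Real.exp_pos (-s)
  nlinarith

theorem one_add_sq_div_four_le_cosh (s : ℝ) : 1 + s ^ 2 / 4 ≤ Real.cosh s := by
  have h1 := Real.quadratic_le_exp_of_nonneg (abs_nonneg s)
  have h2 := Real.add_one_le_exp (-|s|)
  rw [← Real.cosh_abs, Real.cosh_eq, ← sq_abs]
  linarith

theorem integrable_inv_cosh : Integrable fun s : ℝ => (Real.cosh s)⁻¹ := by
  refine (integrable_inv_one_add_sq.const_mul 4).mono'
    (Real.continuous_cosh.inv₀ fun s => (Real.cosh_pos s).ne').aestronglyMeasurable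
    (ae_of_all _ fun s => ?_)
  rw [Real.norm_of_nonneg (inv_nonneg.2 (Real.cosh_pos s).le)]
  have : (Real.cosh s)⁻¹ ≤ ((1 + s ^ 2) / 4)⁻¹ := inv_anti₀ (by positivity)
    (by linarith [one_add_sq_div_four_le_cosh s])
  rwa [inv_div, div_eq_mul_inv] at this

theorem tendsto_inv_cosh_atTop : Tendsto (fun s : ℝ => (Real.cosh s)⁻¹) atTop (𝓝 0) := by
  refine tendsto_inv_atTop_zero.comp (tendsto_atTop_mono (fun s => ?_) tendsto_id)
  have := one_add_sq_div_four_le_cosh s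
  simp only [id]
  nlinarith [sq_nonneg (s - 2)]

theorem tendsto_inv_cosh_atBot : Tendsto (fun s : ℝ => (Real.cosh s)⁻¹) atBot (𝓝 0) := by
  simpa [Function.comp_def] using tendsto_inv_cosh_atTop.comp tendsto_neg_atBot_atTop

/-- This is `x^{n+1} / (n+1)! ≤ e^x` at `x = a cosh s`. It allows `1 / cosh` to serve as the common
integrable majorant, whatever the polynomial growth in `cosh`. -/
theorem cosh_pow_mul_exp_le {a : ℝ} (ha : 0 < a) (n : ℕ) (s : ℝ) :
    Real.cosh s ^ n * Real.exp (-(a * Real.cosh s)) ≤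
      ((n + 1).factorial / a ^ (n + 1)) * (Real.cosh s)⁻¹ := by
  have hc := Real.cosh_pos s
  have h := Real.pow_div_factorial_le_exp (a * Real.cosh s) (by positivity) (n + 1)
  rw [Real.exp_neg, ← div_eq_mul_inv, ← div_eq_mul_inv, div_le_div_iff₀ (Real.exp_pos _) hc,
    ← pow_succ]
  rw [div_le_iff₀ (by positivity), mul_pow] at h
  rw [div_mul_eq_mul_div, le_div_iff₀ (by positivity)]
  linarith

end Hyperbola

/-! ### Convergence and differentiation of integrals along the hyperbola. -/

section HypIntegral

variable {E : Type*} [NormedAddCommGroup E] [NormedSpace ℂ E]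

/-- The integral of `e^{λ z} k` along the hyperbola with parameter `y`. -/
noncomputable def hypIntegral (y : ℝ) (k : ℝ → E) (z : ℂ) : E :=
  ∫ s : ℝ, Complex.exp (hyp (s + y * Complex.I) * z) • k s

/-- `z` belongs to the region in which `e^{λ z}` decays along the hyperbola with parameter `y`,
with constant `κ`. -/
def HypDecay (y κ : ℝ) (z : ℂ) : Prop :=
  (z * Complex.exp (y * Complex.I)).re ≤ -κ ∧ (z * Complex.exp ((-y : ℝ) * Complex.I)).re ≤ -κ

theorem exists_hypDecay {β : ℝ} (hβ : 0 < β) (hβ' : β ≤ π / 2) {z : ℂ} (hz : z ∈ openSector β) :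
    ∃ κ, 0 < κ ∧ HypDecay (β + π / 2) κ z := by
  obtain ⟨h1, h2⟩ := re_mul_exp_neg hβ hβ' hz
  refine ⟨min (-(z * Complex.exp ((β + π / 2 : ℝ) * Complex.I)).re)
    (-(z * Complex.exp ((-(β + π / 2) : ℝ) * Complex.I)).re), lt_min (by linarith) (by linarith),
    ?_, ?_⟩
  · linarith [min_le_left (-(z * Complex.exp ((β + π / 2 : ℝ) * Complex.I)).re)
      (-(z * Complex.exp ((-(β + π / 2) : ℝ) * Complex.I)).re)]
  · linarith [min_le_right (-(z * Complex.exp ((β + π / 2 : ℝ) * Complex.I)).re)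
      (-(z * Complex.exp ((-(β + π / 2) : ℝ) * Complex.I)).re)]

theorem continuous_hyp_line (y : ℝ) : Continuous fun s : ℝ => hyp (s + y * Complex.I) :=
  continuous_hyp.comp (by fun_prop)

/-- Half of `z` stays outside the decaying part, whence `e^{Re z / 2}`; the rest absorbs `cosh^n`.
The point `z` enters only through `κ` and `Re z`, which gives uniformity in `z`. -/
theorem norm_exp_hyp_smul_le {y κ C : ℝ} {n : ℕ} {k : ℝ → E} (hκ : 0 < κ)
    (hk : ∀ s, ‖k s‖ ≤ C * Real.cosh s ^ n) {z : ℂ} (hz : HypDecay y κ z) (s : ℝ) :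
    ‖Complex.exp (hyp (s + y * Complex.I) * z) • k s‖ ≤
      Real.exp (z.re / 2) * (C * ((n + 1).factorial / (κ / 2) ^ (n + 1))) * (Real.cosh s)⁻¹ := by
  have hC : 0 ≤ C := by
    have := (norm_nonneg _).trans (hk 0)
    simpa using this
  have h1 : Real.exp (hyp (s + y * Complex.I) * z).re ≤
      Real.exp (z.re / 2) * Real.exp (-(κ / 2 * Real.cosh s)) := by
    rw [← Real.exp_add]
    exact Real.exp_le_exp.2 (by linarith [re_hyp_mul_le hz.1 hz.2 s])
  rw [norm_smul, Complex.norm_exp]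
  calc _ ≤ (Real.exp (z.re / 2) * Real.exp (-(κ / 2 * Real.cosh s))) * (C * Real.cosh s ^ n) := by
        gcongr; exact hk s
    _ = Real.exp (z.re / 2) * (C * (Real.cosh s ^ n * Real.exp (-(κ / 2 * Real.cosh s)))) := by ring
    _ ≤ Real.exp (z.re / 2) * (C * (((n + 1).factorial / (κ / 2) ^ (n + 1)) * (Real.cosh s)⁻¹)) := by
        exact mul_le_mul_of_nonneg_left (mul_le_mul_of_nonneg_left
          (cosh_pow_mul_exp_le (half_pos hκ) n s) hC) (Real.exp_pos _).le
    _ = _ := by ring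

theorem continuous_exp_hyp_smul {y : ℝ} {k : ℝ → E} (hk : Continuous k) (z : ℂ) :
    Continuous fun s : ℝ => Complex.exp (hyp (s + y * Complex.I) * z) • k s := by
  have := continuous_hyp_line y
  fun_prop

theorem integrable_exp_hyp_smul {y κ C : ℝ} {n : ℕ} {k : ℝ → E} (hkc : Continuous k) (hκ : 0 < κ)
    (hk : ∀ s, ‖k s‖ ≤ C * Real.cosh s ^ n) {z : ℂ} (hz : HypDecay y κ z) :
    Integrable fun s : ℝ => Complex.exp (hyp (s + y * Complex.I) * z) • k s :=
  (integrable_inv_cosh.const_mul _).mono' (continuous_exp_hyp_smul hkc z).aestronglyMeasurable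
    (ae_of_all _ (norm_exp_hyp_smul_le hκ hk hz))

/-- A bound for `hypIntegral`, independent of everything but the displayed parameters. -/
theorem norm_hypIntegral_le {y κ C : ℝ} {n : ℕ} {k : ℝ → E} (hκ : 0 < κ)
    (hk : ∀ s, ‖k s‖ ≤ C * Real.cosh s ^ n) {z : ℂ} (hz : HypDecay y κ z) :
    ‖hypIntegral y k z‖ ≤ Real.exp (z.re / 2) *
      ((C * ((n + 1).factorial / (κ / 2) ^ (n + 1))) * ∫ s : ℝ, (Real.cosh s)⁻¹) := by
  rw [← mul_assoc, ← integral_const_mul]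
  exact norm_integral_le_of_norm_le (integrable_inv_cosh.const_mul _)
    (ae_of_all _ (norm_exp_hyp_smul_le hκ hk hz))

theorem norm_hyp_smul_le {y C : ℝ} {n : ℕ} {k : ℝ → E} (hk : ∀ s, ‖k s‖ ≤ C * Real.cosh s ^ n)
    (s : ℝ) : ‖hyp (s + y * Complex.I) • k s‖ ≤ C * Real.cosh s ^ (n + 1) := by
  rw [norm_smul]
  calc _ ≤ Real.cosh s * (C * Real.cosh s ^ n) :=
        mul_le_mul (norm_hyp_le s y) (hk s) (norm_nonneg _) (Real.cosh_pos s).le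
    _ = _ := by ring

theorem hasDerivAt_hypIntegral {y κ C : ℝ} {n : ℕ} {k : ℝ → E} (hkc : Continuous k) (hκ : 0 < κ)
    (hk : ∀ s, ‖k s‖ ≤ C * Real.cosh s ^ n) {z : ℂ} (hz : HypDecay y κ z) :
    HasDerivAt (hypIntegral y k)
      (hypIntegral y (fun s => hyp (s + y * Complex.I) • k s) z) z := by
  have hC : 0 ≤ C := by
    have := (norm_nonneg _).trans (hk 0)
    simpa using this
  -- A neighbourhood where the decay constant `κ / 2` and an upper bound on the real part hold
  -- uniformly. Differentiation brings down a factor `hyp`, raising the power of `cosh` by one.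
  set U : Set ℂ := {w | (w * Complex.exp (y * Complex.I)).re < -(κ / 2) ∧
    (w * Complex.exp ((-y : ℝ) * Complex.I)).re < -(κ / 2) ∧ w.re < z.re + 1}
  have hU : U ∈ 𝓝 z := by
    refine IsOpen.mem_nhds ?_ ⟨by linarith [hz.1], by linarith [hz.2], by linarith⟩
    have ho : ∀ c : ℂ, IsOpen {w : ℂ | (w * c).re < -(κ / 2)} := fun c =>
      isOpen_lt (by fun_prop) continuous_const
    exact (ho _).inter ((ho _).inter (isOpen_lt Complex.continuous_re continuous_const))
  have hdec : ∀ w ∈ U, HypDecay y (κ / 2) w := fun w hw => ⟨hw.1.le, hw.2.1.le⟩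
  have hkc' : Continuous fun s : ℝ => hyp (s + y * Complex.I) • k s :=
    (continuous_hyp_line y).smul hkc
  refine (hasDerivAt_integral_of_dominated_loc_of_deriv_le (𝕜 := ℂ)
    (F := fun w s => Complex.exp (hyp (s + y * Complex.I) * w) • k s)
    (F' := fun w s => Complex.exp (hyp (s + y * Complex.I) * w) • (hyp (s + y * Complex.I) • k s))
    (bound := fun s => Real.exp ((z.re + 1) / 2) *
      (C * ((n + 1 + 1).factorial / (κ / 2 / 2) ^ (n + 1 + 1))) * (Real.cosh s)⁻¹)
    hU (Eventually.of_forall fun w => (continuous_exp_hyp_smul hkc w).aestronglyMeasurable)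
    (integrable_exp_hyp_smul hkc hκ hk hz)
    (continuous_exp_hyp_smul hkc' z).aestronglyMeasurable
    (ae_of_all _ fun s w hw => ?_) (integrable_inv_cosh.const_mul _)
    (ae_of_all _ fun s w hw => ?_)).2
  · refine (norm_exp_hyp_smul_le (half_pos hκ) (norm_hyp_smul_le hk) (hdec w hw) s).trans ?_
    have := hw.2.2
    have := Real.cosh_pos s
    gcongr
  · have := (((hasDerivAt_id w).const_mul (hyp (s + y * Complex.I))).cexp).smul_const (k s)
    simpa [smul_smul] using this

end HypIntegral

/-! ### Scalar integrals along the hyperbola. -/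

section ScalarIntegrals

theorem HypDecay.ne_zero {y κ : ℝ} (hκ : 0 < κ) {z : ℂ} (hz : HypDecay y κ z) : z ≠ 0 := by
  rintro rfl
  have := hz.1
  simp at this
  linarith

theorem HypDecay.mul {y κ : ℝ} {z : ℂ} (hz : HypDecay y κ z) {t : ℝ} (ht : 0 ≤ t) :
    HypDecay y (t * κ) (t * z) := by
  constructor
  · rw [mul_assoc, Complex.re_ofReal_mul]; nlinarith [hz.1]
  · rw [mul_assoc, Complex.re_ofReal_mul]; nlinarith [hz.2]

theorem HypDecay.mono {y κ κ' : ℝ} {z : ℂ} (hz : HypDecay y κ z) (h : κ' ≤ κ) :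
    HypDecay y κ' z := ⟨by linarith [hz.1], by linarith [hz.2]⟩

theorem hasDerivAt_line (y s : ℝ) : HasDerivAt (fun s : ℝ => (s + y * Complex.I : ℂ)) 1 s :=
  ((hasDerivAt_id (s : ℂ)).add_const _).comp_ofReal

theorem hasDerivAt_hyp_line (y s : ℝ) : HasDerivAt (fun s : ℝ => hyp (s + y * Complex.I))
    (Complex.sinh (s + y * Complex.I) / 2) s := by
  have := (hasDerivAt_hyp (s + y * Complex.I)).comp s (hasDerivAt_line y s)
  simpa [Function.comp_def] using this

theorem continuous_sinh_line (y : ℝ) :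
    Continuous fun s : ℝ => Complex.sinh (s + y * Complex.I) / 2 := by
  fun_prop

/-- The integrand `e^{λz} dλ` is the differential of `e^{λz} / z`, which vanishes at both ends of
the hyperbola. -/
theorem hypIntegral_sinh {y κ : ℝ} (hκ : 0 < κ) {z : ℂ} (hz : HypDecay y κ z) :
    hypIntegral y (fun s => Complex.sinh (s + y * Complex.I) / 2) z = 0 := by
  have hz0 := hz.ne_zero hκ
  have hd : ∀ s : ℝ, HasDerivAt (fun s : ℝ => Complex.exp (hyp (s + y * Complex.I) * z) / z)
      (Complex.exp (hyp (s + y * Complex.I) * z) • (Complex.sinh (s + y * Complex.I) / 2)) s := by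
    intro s
    have := (((hasDerivAt_hyp_line y s).mul_const z).cexp).div_const z
    exact this.congr_deriv (by rw [smul_eq_mul]; field_simp)
  have hi := integrable_exp_hyp_smul (n := 1) (C := 1) (continuous_sinh_line y) hκ
    (fun s => by simpa using norm_sinh_div_two_le s y) hz
  have hb := norm_exp_hyp_smul_le (y := y) (n := 0) (C := 1) (k := fun _ => (1 : ℂ)) hκ (by simp) hz
  have ht : ∀ l : Filter ℝ, Tendsto (fun s : ℝ => (Real.cosh s)⁻¹) l (𝓝 0) →
      Tendsto (fun s : ℝ => Complex.exp (hyp (s + y * Complex.I) * z) / z) l (𝓝 0) := by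
    intro l hl
    have h1 := squeeze_zero_norm hb (by simpa using hl.const_mul _)
    simpa using h1.div_const z
  have := integral_of_hasDerivAt_of_tendsto hd hi (ht _ tendsto_inv_cosh_atBot)
    (ht _ tendsto_inv_cosh_atTop)
  rw [hypIntegral, this, sub_zero]

theorem one_sub_hyp_ne_zero {y : ℝ} (hy : Real.cos y < 0) (s : ℝ) :
    1 - hyp (s + y * Complex.I) ≠ 0 := by
  rw [← norm_pos_iff, norm_one_sub_hyp]
  linarith [Real.cosh_pos s]

theorem norm_sinh_div_one_sub_hyp_le {y : ℝ} (hy : Real.cos y < 0) (s : ℝ) :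
    ‖Complex.sinh (s + y * Complex.I) / 2 / (1 - hyp (s + y * Complex.I))‖ ≤ 2 := by
  have := Real.cosh_pos s
  rw [norm_div, norm_one_sub_hyp, div_le_iff₀ (by linarith)]
  linarith [norm_sinh_div_two_le s y]

theorem continuous_sinh_div_one_sub_hyp {y : ℝ} (hy : Real.cos y < 0) : Continuous fun s : ℝ =>
    Complex.sinh (s + y * Complex.I) / 2 / (1 - hyp (s + y * Complex.I)) :=
  (continuous_sinh_line y).div (continuous_const.sub (continuous_hyp_line y))
    (one_sub_hyp_ne_zero hy)

/-- The pole `1` lies to the right of the contour, so the integral `J` should vanish; no closing of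
the contour is needed. From `λ / (1 - λ) = 1 / (1 - λ) - 1` and `hypIntegral_sinh` follows `J' = J`,
so `J(tz)` is a multiple of `e^{tz}`. But `J(tz)` is only `O(e^{t Re z / 2})` for `t ≥ 1`, which
forces `J = 0`. -/
theorem hypIntegral_sinh_div_one_sub_hyp {y κ : ℝ} (hy : Real.cos y < 0) (hκ : 0 < κ) {z : ℂ}
    (hz : HypDecay y κ z) (hre : 0 < z.re) :
    hypIntegral y
      (fun s => Complex.sinh (s + y * Complex.I) / 2 / (1 - hyp (s + y * Complex.I))) z = 0 := by
  set k : ℝ → ℂ := fun s => Complex.sinh (s + y * Complex.I) / 2 / (1 - hyp (s + y * Complex.I))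
  have hkc : Continuous k := continuous_sinh_div_one_sub_hyp hy
  have hkb : ∀ s, ‖k s‖ ≤ 2 * Real.cosh s ^ 0 := fun s => by
    simpa only [pow_zero, mul_one] using norm_sinh_div_one_sub_hyp_le hy s
  have hdec : ∀ t : ℝ, 1 ≤ t → HypDecay y κ (t * z) := fun t ht =>
    (hz.mul (by linarith)).mono (by nlinarith)
  have hJ : ∀ w : ℂ, HypDecay y κ w → HasDerivAt (hypIntegral y k) (hypIntegral y k w) w := by
    intro w hw
    have h1 := hasDerivAt_hypIntegral hkc hκ hkb hw
    have h2 : hypIntegral y (fun s => hyp (s + y * Complex.I) • k s) w =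
        hypIntegral y k w - hypIntegral y (fun s => Complex.sinh (s + y * Complex.I) / 2) w := by
      unfold hypIntegral
      rw [← integral_sub (integrable_exp_hyp_smul hkc hκ hkb hw)
        (integrable_exp_hyp_smul (n := 1) (C := 1) (continuous_sinh_line y) hκ
        (fun s => by simpa using norm_sinh_div_two_le s y) hw)]
      congr 1
      ext s
      have := one_sub_hyp_ne_zero hy s
      rw [← smul_sub]
      congr 1
      simp only [k, smul_eq_mul]
      field_simp
      ring
    rw [h2, hypIntegral_sinh hκ hw, sub_zero] at h1
    exact h1
  set V : ℝ → ℂ := fun t => Complex.exp (-(t * z)) * hypIntegral y k (t * z)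
  have hVd : ∀ t : ℝ, 1 ≤ t → HasDerivAt V 0 t := by
    intro t ht
    have h1 : HasDerivAt (fun w : ℂ => Complex.exp (-(w * z)) * hypIntegral y k (w * z)) 0 t := by
      have e1 : HasDerivAt (fun w : ℂ => w * z) z t := by
        simpa using (hasDerivAt_id (t : ℂ)).mul_const z
      have := e1.neg.cexp.mul ((hJ _ (hdec t ht)).comp (t : ℂ) e1)
      refine this.congr_deriv ?_
      simp only [Function.comp_apply]
      ring
    exact h1.comp_ofReal
  have hV1 : ∀ t : ℝ, 1 ≤ t → V t = V 1 := by
    intro t ht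
    exact constant_of_has_deriv_right_zero
      (fun x hx => (hVd x hx.1).continuousAt.continuousWithinAt)
      (fun x hx => (hVd x hx.1).hasDerivWithinAt) t ⟨ht, le_rfl⟩
  have hVlim : Tendsto V atTop (𝓝 0) := by
    set B := (2 * (((0 + 1).factorial : ℝ) / (κ / 2) ^ (0 + 1))) * ∫ s : ℝ, (Real.cosh s)⁻¹
    refine squeeze_zero_norm' (a := fun t : ℝ => Real.exp (-(z.re / 2 * t)) * B) ?_ ?_
    · filter_upwards [eventually_ge_atTop 1] with t ht
      have h1 := norm_hypIntegral_le hκ hkb (hdec t ht)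
      have h2 : (-((t : ℂ) * z)).re = -(t * z.re) := by simp
      simp only [V]
      rw [norm_mul, Complex.norm_exp, h2]
      calc _ ≤ Real.exp (-(t * z.re)) * (Real.exp ((↑t * z).re / 2) * B) := by gcongr
        _ = _ := by
          rw [← mul_assoc, ← Real.exp_add, Complex.re_ofReal_mul]
          congr 2
          ring
    · have := (Real.tendsto_exp_neg_atTop_nhds_zero.comp
        (tendsto_id.const_mul_atTop (half_pos hre))).mul_const B
      simpa [Function.comp_def] using this
  have h0 : V 1 = 0 := by
    refine tendsto_nhds_unique (tendsto_const_nhds.congr' ?_) hVlim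
    filter_upwards [eventually_ge_atTop 1] with t ht using (hV1 t ht).symm
  simpa [V] using h0

/-- A normalisation integral, by the residue at the two points over `1`. -/
theorem integral_sinh_inv {y : ℝ} (hy0 : 0 < y) (hyπ : y < π) (hy : Real.cos y < 0) :
    Integrable (fun s : ℝ => Complex.sinh (s + y * Complex.I) / 2 *
      (1 / hyp (s + y * Complex.I) + 1 / (1 - hyp (s + y * Complex.I)))) ∧
    ∫ s : ℝ, Complex.sinh (s + y * Complex.I) / 2 *
      (1 / hyp (s + y * Complex.I) + 1 / (1 - hyp (s + y * Complex.I))) = 2 * π * Complex.I := by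
  have hc1 : -1 < Real.cos y := by
    rw [← Real.cos_pi]
    exact Real.cos_lt_cos_of_nonneg_of_le_pi hy0.le le_rfl hyπ
  have hh0 : ∀ s : ℝ, hyp (s + y * Complex.I) ≠ 0 := fun s => by
    rw [← norm_pos_iff, norm_hyp]
    linarith [Real.one_le_cosh s]
  have hh1 := one_sub_hyp_ne_zero hy
  have hsin : 0 < Real.sin y := Real.sin_pos_of_pos_of_lt_pi hy0 hyπ
  have e0 : ∀ s : ℝ, Complex.sinh (s + y * Complex.I) / 2 *
      (1 / hyp (s + y * Complex.I) + 1 / (1 - hyp (s + y * Complex.I))) =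
      Complex.sinh (s + y * Complex.I) / 2 / (1 - hyp (s + y * Complex.I)) *
        (hyp (s + y * Complex.I))⁻¹ := by
    intro s
    have := hh0 s
    have := hh1 s
    field_simp
    ring
  have hint : Integrable (fun s : ℝ => Complex.sinh (s + y * Complex.I) / 2 *
      (1 / hyp (s + y * Complex.I) + 1 / (1 - hyp (s + y * Complex.I)))) := by
    simp_rw [e0]
    refine (integrable_inv_cosh.const_mul (2 * ((1 + Real.cos y) / 2)⁻¹)).mono'
      ((continuous_sinh_div_one_sub_hyp hy).mul
        ((continuous_hyp_line y).inv₀ hh0)).aestronglyMeasurable (ae_of_all _ fun s => ?_)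
    rw [norm_mul, mul_assoc, ← mul_inv, norm_inv]
    have h1 := le_norm_hyp (s := s) hy.le le_rfl
    have h2 := norm_sinh_div_one_sub_hyp_le hy s
    have h3 : 0 < (1 + Real.cos y) / 2 * Real.cosh s :=
      mul_pos (by linarith) (Real.cosh_pos s)
    gcongr
  refine ⟨hint, ?_⟩
  -- This is `-i tanh (w / 2)`. The integrand equals `-2 / sinh w`, with primitive `-2 log tanh (w /
  -- 2)`; the factor `-i` moves the argument into the right half plane, where the principal
  -- logarithm is differentiable. The limits `i` and `-i` at the two ends produce `2πi`.
  set v : ℂ → ℂ := fun w => -Complex.I * ((Complex.exp w - 1) / (Complex.exp w + 1))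
  have him : ∀ s : ℝ, 0 < (Complex.exp (s + y * Complex.I)).im := fun s => by
    rw [Complex.exp_im]
    simpa using mul_pos (Real.exp_pos s) hsin
  have hm1 : ∀ s : ℝ, Complex.exp (s + y * Complex.I) - 1 ≠ 0 := fun s h => by
    have := congrArg Complex.im h
    simp only [Complex.sub_im, Complex.one_im, Complex.zero_im] at this
    linarith [him s]
  have hp1 : ∀ s : ℝ, Complex.exp (s + y * Complex.I) + 1 ≠ 0 := fun s h => by
    have := congrArg Complex.im h
    simp only [Complex.add_im, Complex.one_im, Complex.zero_im] at this
    linarith [him s]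
  have hv : ∀ s : ℝ, 0 < (v (s + y * Complex.I)).re := by
    intro s
    have h1 : (v (s + y * Complex.I)).re = ((Complex.exp (s + y * Complex.I) - 1) /
        (Complex.exp (s + y * Complex.I) + 1)).im := by
      simp [v]
    rw [h1, Complex.div_im]
    have h2 := Complex.normSq_pos.2 (hp1 s)
    rw [← sub_div]
    refine div_pos ?_ h2
    simp only [Complex.sub_im, Complex.add_im, Complex.sub_re, Complex.add_re, Complex.one_im,
      Complex.one_re]
    linarith [him s]
  have hd : ∀ s : ℝ, HasDerivAt (fun s : ℝ => -2 * Complex.log (v (s + y * Complex.I)))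
      (Complex.sinh (s + y * Complex.I) / 2 *
      (1 / hyp (s + y * Complex.I) + 1 / (1 - hyp (s + y * Complex.I)))) s := by
    intro s
    set w : ℂ := s + y * Complex.I
    have d1 : HasDerivAt v (-Complex.I * ((Complex.exp w * (Complex.exp w + 1) -
        (Complex.exp w - 1) * Complex.exp w) / (Complex.exp w + 1) ^ 2)) w :=
      (((Complex.hasDerivAt_exp w).sub_const 1).div ((Complex.hasDerivAt_exp w).add_const 1)
        (hp1 s)).const_mul _
    have d2 := ((d1.clog (Or.inl (hv s))).const_mul (-2)).comp s (hasDerivAt_line y s)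
    refine d2.congr_deriv ?_
    have a1 := hh0 s
    have a2 := hh1 s
    have a3 := hm1 s
    have a4 := hp1 s
    have a5 := Complex.exp_ne_zero w
    change hyp w ≠ 0 at a1
    change 1 - hyp w ≠ 0 at a2
    change Complex.exp w - 1 ≠ 0 at a3
    change Complex.exp w + 1 ≠ 0 at a4
    have b1 : hyp w = (Complex.exp w + 1) ^ 2 / (4 * Complex.exp w) := by
      rw [hyp, Complex.cosh, Complex.exp_neg]
      field_simp
      ring
    have b2 : 1 - hyp w = -(Complex.exp w - 1) ^ 2 / (4 * Complex.exp w) := by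
      rw [b1]
      field_simp
      ring
    have b3 : Complex.sinh w = (Complex.exp w - 1) * (Complex.exp w + 1) / (2 * Complex.exp w) := by
      rw [Complex.sinh, Complex.exp_neg]
      field_simp
      ring
    rw [b2, b1, b3]
    simp only [v]
    field_simp
    ring
  have hexpN : Tendsto (fun s : ℝ => Complex.exp (s + y * Complex.I)) atBot (𝓝 0) := by
    rw [tendsto_zero_iff_norm_tendsto_zero]
    simpa [Complex.norm_exp] using Real.tendsto_exp_atBot
  have hexpP : Tendsto (fun s : ℝ => Complex.exp (-(s + y * Complex.I))) atTop (𝓝 0) := by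
    rw [tendsto_zero_iff_norm_tendsto_zero]
    simpa [Complex.norm_exp] using Real.tendsto_exp_neg_atTop_nhds_zero
  have hvB : Tendsto (fun s : ℝ => v (s + y * Complex.I)) atBot (𝓝 Complex.I) := by
    have := ((hexpN.sub_const 1).div (hexpN.add_const 1) (by simp)).const_mul (-Complex.I)
    simpa [v] using this
  have hvT : Tendsto (fun s : ℝ => v (s + y * Complex.I)) atTop (𝓝 (-Complex.I)) := by
    have := ((hexpP.const_sub 1).div (hexpP.const_add 1) (by simp)).const_mul (-Complex.I)
    simp only [sub_zero, add_zero, div_one, mul_one] at this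
    refine this.congr fun s => ?_
    simp only [v, Pi.div_apply]
    have a4 := hp1 s
    rw [Complex.exp_neg]
    have a5 := Complex.exp_ne_zero (s + y * Complex.I)
    congr 1
    have a6 : 1 + (Complex.exp (s + y * Complex.I))⁻¹ ≠ 0 := by
      intro h
      apply a4
      field_simp at h
      linear_combination h
    field_simp
  have lB := (hvB.clog (Or.inr (by simp))).const_mul (-2)
  have lT := (hvT.clog (Or.inr (by simp))).const_mul (-2)
  rw [integral_of_hasDerivAt_of_tendsto hd hint lB lT, Complex.log_I, Complex.log_neg_I]
  ring

end ScalarIntegrals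

/-! ### Pseudo-resolvents on a sector. -/

section PseudoResolvent

variable {𝔸 : Type*} [NormedRing 𝔸] [NormedAlgebra ℂ 𝔸]

/-- A solution `R` of the resolvent identity on a sector with `‖λ R(λ)‖ ≤ M`. -/
structure IsPseudoResolvent (γ M : ℝ) (R : ℂ → 𝔸) : Prop where
  sub_eq : ∀ l ∈ openSector γ, ∀ m ∈ openSector γ, R l - R m = (m - l) • (R l * R m)
  norm_le : ∀ l ∈ openSector γ, ‖l‖ * ‖R l‖ ≤ M

variable {γ M : ℝ} {R : ℂ → 𝔸}

namespace IsPseudoResolvent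

theorem mul_comm (hR : IsPseudoResolvent γ M R) {l m : ℂ} (hl : l ∈ openSector γ)
    (hm : m ∈ openSector γ) : R l * R m = R m * R l := by
  rcases eq_or_ne l m with rfl | h
  · rfl
  have h1 := hR.sub_eq l hl m hm
  have h2 := hR.sub_eq m hm l hl
  rw [← neg_sub, h1, ← neg_smul, neg_sub] at h2
  exact smul_right_injective 𝔸 (sub_ne_zero.2 h) h2

theorem norm_le_div (hR : IsPseudoResolvent γ M R) {l : ℂ} (hl : l ∈ openSector γ) :
    ‖R l‖ ≤ M / ‖l‖ := by
  rw [le_div_iff₀ (norm_pos_iff.2 hl.1), _root_.mul_comm]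
  exact hR.norm_le l hl

theorem nonneg (hR : IsPseudoResolvent γ M R) (hγ : 0 < γ) : 0 ≤ M :=
  (mul_nonneg (norm_nonneg _) (norm_nonneg _)).trans
    (hR.norm_le 1 (by simpa using ofReal_mem_openSector hγ one_pos))

theorem norm_sq_le (hR : IsPseudoResolvent γ M R) {l : ℂ} (hl : l ∈ openSector γ) :
    ‖R l * R l‖ ≤ M ^ 2 / ‖l‖ ^ 2 := by
  have h1 := hR.norm_le_div hl
  rw [← div_pow, pow_two]
  exact (norm_mul_le _ _).trans (mul_le_mul h1 h1 (norm_nonneg _) ((norm_nonneg _).trans h1))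

theorem continuousAt (hR : IsPseudoResolvent γ M R) (hγ : γ ≤ π) {l : ℂ}
    (hl : l ∈ openSector γ) : ContinuousAt R l := by
  have hn := norm_pos_iff.2 hl.1
  have hγ0 : 0 < γ := (abs_nonneg _).trans_lt hl.2
  have hM := hR.nonneg hγ0
  rw [ContinuousAt, tendsto_iff_norm_sub_tendsto_zero]
  refine squeeze_zero' (Eventually.of_forall fun _ => norm_nonneg _)
    (g := fun m => ‖l - m‖ * (M / (‖l‖ / 2) * (M / ‖l‖))) ?_ ?_
  · have h1 : ∀ᶠ m in 𝓝 l, ‖l‖ / 2 < ‖m‖ :=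
      continuous_norm.continuousAt.eventually (lt_mem_nhds (by linarith))
    filter_upwards [(isOpen_openSector hγ).mem_nhds hl, h1] with m hm hm1
    rw [hR.sub_eq m hm l hl, norm_smul]
    refine mul_le_mul_of_nonneg_left ((norm_mul_le _ _).trans ?_) (norm_nonneg _)
    refine mul_le_mul ((hR.norm_le_div hm).trans ?_) (hR.norm_le_div hl) (norm_nonneg _)
      (by positivity)
    exact div_le_div_of_nonneg_left hM (by linarith) hm1.le
  · have hc : Continuous fun m : ℂ => ‖l - m‖ * (M / (‖l‖ / 2) * (M / ‖l‖)) := by fun_prop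
    simpa using hc.tendsto l

theorem hasDerivAt (hR : IsPseudoResolvent γ M R) (hγ : γ ≤ π) {l : ℂ}
    (hl : l ∈ openSector γ) : HasDerivAt R (-(R l * R l)) l := by
  rw [hasDerivAt_iff_tendsto_slope]
  have h1 : Tendsto (fun m => -(R l * R m)) (𝓝[≠] l) (𝓝 (-(R l * R l))) :=
    (((hR.continuousAt hγ hl).tendsto.const_mul (R l)).neg).mono_left nhdsWithin_le_nhds
  refine h1.congr' ?_
  filter_upwards [self_mem_nhdsWithin,
    nhdsWithin_le_nhds ((isOpen_openSector hγ).mem_nhds hl)] with m hm hm1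
  rw [slope_def_module, ← neg_sub (R l), hR.sub_eq l hl m hm1, smul_neg, smul_smul,
    inv_mul_cancel₀ (sub_ne_zero.2 hm), one_smul]

/-- Points near `1` have small argument. -/
theorem one_add_mem_openSector {ε : ℝ} (hε : 0 < ε) (hε' : ε < π / 2) {w : ℂ}
    (hw : ‖w‖ ≤ Real.sin ε / 2) : 1 + w ∈ openSector ε := by
  have hs : 0 < Real.sin ε := Real.sin_pos_of_pos_of_lt_pi hε (by linarith [Real.pi_pos])
  have hs1 : Real.sin ε < 1 := by
    rw [← Real.sin_pi_div_two]
    exact Real.sin_lt_sin_of_lt_of_le_pi_div_two (by linarith) le_rfl hε'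
  rw [mem_openSector_iff hε hε'.le]
  have h1 := Complex.abs_re_le_norm w
  have h2 := Complex.abs_im_le_norm w
  have h3 := (abs_le.1 h1).1
  have h4 : 0 < Real.cos ε := Real.cos_pos_of_mem_Ioo ⟨by linarith, hε'⟩
  have h5 := Real.cos_le_one ε
  simp only [Complex.add_re, Complex.one_re, Complex.add_im, Complex.one_im, zero_add]
  calc |w.im| * Real.cos ε ≤ Real.sin ε / 2 * 1 := by
        refine mul_le_mul (h2.trans hw) h5 h4.le (by linarith)
    _ < (1 + w.re) * Real.sin ε := by nlinarith

/-- Since `R² = -R'`, Cauchy's estimate applies on the disc about `l` of radius `|l| sin ε / 2`,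
which stays in the large sector and on which `‖R‖ ≤ 2 M / |l|`. Unlike `norm_sq_le`, this bound is
linear in `M`. -/
theorem norm_sq_le_of_sin {α ε : ℝ} (hα : α ≤ π / 2) (hR : IsPseudoResolvent (α + π / 2) M R)
    (hε : 0 < ε) (hε' : ε < α) {l : ℂ} (hl : l ∈ openSector (α + π / 2 - ε)) :
    ‖R l * R l‖ ≤ 4 * M / Real.sin ε / ‖l‖ ^ 2 := by
  have hπ := Real.pi_pos
  have hM := hR.nonneg (by linarith)
  have hs : 0 < Real.sin ε := Real.sin_pos_of_pos_of_lt_pi hε (by linarith)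
  have hn : 0 < ‖l‖ := norm_pos_iff.2 hl.1
  have hl' : l ∈ openSector (α + π / 2) := openSector_mono (by linarith) hl
  set r := ‖l‖ * (Real.sin ε / 2)
  have hr : 0 < r := by positivity
  have hball : ∀ w ∈ Metric.closedBall l r, w ∈ openSector (α + π / 2) := by
    intro w hw
    rw [mem_closedBall_iff_norm] at hw
    have h1 : ‖(w - l) / l‖ ≤ Real.sin ε / 2 := by
      rw [norm_div, div_le_iff₀ hn, _root_.mul_comm]
      exact hw
    have h2 := mul_mem_openSector (by linarith) hl
      (one_add_mem_openSector hε (by linarith) h1)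
    have h3 : l * (1 + (w - l) / l) = w := by
      have := hl.1
      field_simp
      ring
    rwa [h3, sub_add_cancel] at h2
  have hderiv := (hR.hasDerivAt (by linarith) hl').deriv
  have h4 := Complex.norm_deriv_le_of_forall_mem_sphere_norm_le (f := R) (c := l) (R := r)
    (C := 2 * M / ‖l‖) hr ?_ ?_
  · rw [hderiv, norm_neg] at h4
    refine h4.trans_eq ?_
    simp only [r]
    field_simp
    ring
  · refine DifferentiableOn.diffContOnCl fun w hw => ?_
    have hw' := Metric.closure_ball_subset_closedBall hw
    exact (hR.hasDerivAt (by linarith) (hball w hw')).differentiableAt.differentiableWithinAt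
  · intro w hw
    have h5 := hR.norm_le_div (hball w (Metric.sphere_subset_closedBall hw))
    have h6 : ‖l‖ / 2 ≤ ‖w‖ := by
      rw [mem_sphere_iff_norm] at hw
      have h7 := norm_sub_norm_le l w
      rw [norm_sub_rev, hw] at h7
      have h8 := Real.sin_le_one ε
      have : r ≤ ‖l‖ * (1 / 2) := by simp only [r]; gcongr
      linarith
    refine h5.trans ?_
    calc M / ‖w‖ ≤ M / (‖l‖ / 2) := by gcongr
      _ = 2 * M / ‖l‖ := by field_simp

/-- Scale invariance of the constant `M`: it turns a bound at one point into a bound along a whole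
ray. -/
theorem rescale (hR : IsPseudoResolvent γ M R) {c : ℝ} (hc : 0 < c) :
    IsPseudoResolvent γ M fun l => (c : ℂ) • R (c * l) := by
  refine ⟨fun l hl m hm => ?_, fun l hl => ?_⟩
  · have := hR.sub_eq _ (real_mul_mem_openSector hl hc) _ (real_mul_mem_openSector hm hc)
    rw [← smul_sub, this, smul_mul_smul_comm, smul_smul, smul_smul]
    congr 1
    ring
  · have := hR.norm_le _ (real_mul_mem_openSector hl hc)
    rw [norm_mul] at this
    rw [norm_smul]
    linarith

end IsPseudoResolvent

/-- `S` is the semigroup with resolvent `R`. -/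
structure IsSemigroupOf (γ β : ℝ) (R S : ℂ → 𝔸) : Prop where
  differentiableOn : DifferentiableOn ℂ S (openSector β)
  commute : ∀ m ∈ openSector γ, ∀ z ∈ openSector β, R m * S z = S z * R m
  mul_deriv : ∀ m ∈ openSector γ, ∀ z ∈ openSector β,
    R m * deriv S z = m • (R m * S z) - S z
  tendsto : ∀ m ∈ openSector γ, ∀ z ∈ openSector β,
    Tendsto (fun r : ℝ => R m * S (r * z)) (𝓝[>] 0) (𝓝 (R m))

/-! ### Semigroup law and uniqueness from the four characterising properties. -/

namespace IsSemigroupOf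

variable {β : ℝ} {S S₁ S₂ : ℂ → 𝔸}

theorem mono (h : IsSemigroupOf γ β R S) {β' : ℝ} (hβ : β' ≤ β) : IsSemigroupOf γ β' R S :=
  ⟨h.differentiableOn.mono (openSector_mono hβ),
    fun m hm z hz => h.commute m hm z (openSector_mono hβ hz),
    fun m hm z hz => h.mul_deriv m hm z (openSector_mono hβ hz),
    fun m hm z hz => h.tendsto m hm z (openSector_mono hβ hz)⟩

theorem hasDerivAt (h : IsSemigroupOf γ β R S) (hβ : β ≤ π / 2) {z : ℂ}
    (hz : z ∈ openSector β) : HasDerivAt S (deriv S z) z :=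
  (h.differentiableOn.differentiableAt
    ((isOpen_openSector (by linarith [Real.pi_pos])).mem_nhds hz)).hasDerivAt

/-- A differentiable function `D` with `R D' = μ R D - D` and `R D = 0` vanishes. -/
theorem eq_zero_of_mul_eq_zero {U : Set ℂ} (hU : IsOpen U) {Q : 𝔸} {m : ℂ} {D D' : ℂ → 𝔸}
    (hD : ∀ z ∈ U, HasDerivAt D (D' z) z) (hD' : ∀ z ∈ U, Q * D' z = m • (Q * D z) - D z)
    (h0 : ∀ z ∈ U, Q * D z = 0) {z : ℂ} (hz : z ∈ U) : D z = 0 := by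
  have h1 := (hD z hz).const_mul Q
  have h2 : HasDerivAt (fun z => Q * D z) 0 z := by
    refine (hasDerivAt_const z (0 : 𝔸)).congr_of_eventuallyEq ?_
    filter_upwards [hU.mem_nhds hz] with w hw using h0 w hw
  have h3 := h1.unique h2
  rw [hD' z hz, h0 z hz, smul_zero, zero_sub, neg_eq_zero] at h3
  exact h3

/-- The path `S₁ (z + (1 - r) w) R(1) S₂ (r w)` has zero derivative: the terms without `R(1)` cancel
and those with it agree by commutation. Its value at `r = 1` is compared with its limit at `r = 0`,
and `R(1)` is then removed by `eq_zero_of_mul_eq_zero`. Two families are allowed so that uniqueness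
can be deduced. -/
theorem mul_eq (hγ : 0 < γ) (hβ₀ : 0 < β) (hβ : β ≤ π / 2) (h₁ : IsSemigroupOf γ β R S₁)
    (h₂ : IsSemigroupOf γ β R S₂) {z w : ℂ} (hz : z ∈ openSector β) (hw : w ∈ openSector β) :
    S₁ z * S₂ w = S₁ (z + w) := by
  have h1γ : (1 : ℂ) ∈ openSector γ := by simpa using ofReal_mem_openSector hγ one_pos
  have hopen := isOpen_openSector (γ := β) (by linarith [Real.pi_pos])
  have key : ∀ z ∈ openSector β, R 1 * (S₁ z * S₂ w - S₁ (z + w)) = 0 := by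
    intro z hz
    have hmem : ∀ r : ℝ, r < 1 → z + (1 - r : ℝ) * w ∈ openSector β := fun r hr =>
      add_mem_openSector hβ₀ hβ hz (real_mul_mem_openSector hw (by linarith))
    have hmem' : ∀ r : ℝ, r ≤ 1 → z + (1 - r : ℝ) * w ∈ openSector β := fun r hr => by
      rcases hr.lt_or_eq with h | rfl
      · exact hmem r h
      · simpa using hz
    set V : ℝ → 𝔸 := fun r => S₁ (z + (1 - r : ℝ) * w) * (R 1 * S₂ (r * w))
    have hVd : ∀ r : ℝ, 0 < r → r ≤ 1 → HasDerivAt V 0 r := by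
      intro r hr hr1
      have hrw := real_mul_mem_openSector hw hr
      have a1 : HasDerivAt (fun r : ℝ => z + ((1 - r : ℝ) : ℂ) * w) (-w) r := by
        have : HasDerivAt (fun r : ℂ => z + (1 - r) * w) (-w) (r : ℂ) := by
          simpa using (((hasDerivAt_id (r : ℂ)).const_sub 1).mul_const w).const_add z
        simpa using this.comp_ofReal
      have a2 : HasDerivAt (fun r : ℝ => (r : ℂ) * w) w r := by
        have : HasDerivAt (fun r : ℂ => r * w) w (r : ℂ) := by
          simpa using (hasDerivAt_id (r : ℂ)).mul_const w
        exact this.comp_ofReal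
      have b1 := (h₁.hasDerivAt hβ (hmem' r hr1)).scomp r a1
      have b2 := ((h₂.hasDerivAt hβ hrw).scomp r a2).const_mul (R 1)
      refine (b1.mul b2).congr_deriv ?_
      simp only [Function.comp_apply]
      rw [mul_smul_comm, h₂.mul_deriv 1 h1γ _ hrw, smul_mul_assoc, ← mul_assoc (deriv S₁ _)]
      have c1 : deriv S₁ (z + ((1 - r : ℝ) : ℂ) * w) * R 1 =
          R 1 * deriv S₁ (z + ((1 - r : ℝ) : ℂ) * w) := by
        have e1 := (h₁.hasDerivAt hβ (hmem' r hr1)).const_mul (R 1)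
        have e2 := (h₁.hasDerivAt hβ (hmem' r hr1)).mul_const (R 1)
        refine (e2.congr_of_eventuallyEq ?_).unique e1 |>.symm ▸ rfl
        filter_upwards [hopen.mem_nhds (hmem' r hr1)] with v hv using h₁.commute 1 h1γ v hv
      rw [c1, h₁.mul_deriv 1 h1γ _ (hmem' r hr1), h₁.commute 1 h1γ _ (hmem' r hr1)]
      simp only [one_smul, sub_mul, mul_sub, mul_smul_comm, mul_assoc, neg_smul]
      abel
    have hconst : ∀ r : ℝ, 0 < r → r ≤ 1 → V r = V 1 := by
      intro r hr hr1
      exact (constant_of_has_deriv_right_zero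
        (fun x hx => (hVd x (hr.trans_le hx.1) hx.2).continuousAt.continuousWithinAt)
        (fun x hx => (hVd x (hr.trans_le hx.1) hx.2.le).hasDerivWithinAt) 1 ⟨hr1, le_rfl⟩).symm
    have hlim : Tendsto V (𝓝[>] 0) (𝓝 (S₁ (z + w) * R 1)) := by
      refine Tendsto.mul ?_ (h₂.tendsto 1 h1γ w hw)
      have c1 : ContinuousAt S₁ (z + (1 - (0 : ℝ) : ℝ) * w) :=
        (h₁.hasDerivAt hβ (hmem 0 one_pos)).continuousAt
      have c2 : ContinuousAt (fun r : ℝ => z + ((1 - r : ℝ) : ℂ) * w) 0 := by fun_prop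
      have c3 := (ContinuousAt.comp (f := fun r : ℝ => z + ((1 - r : ℝ) : ℂ) * w) c1 c2).tendsto
      simp only [Function.comp_apply, sub_zero, Complex.ofReal_one, one_mul] at c3
      exact c3.mono_left nhdsWithin_le_nhds
    have hV1 : V 1 = S₁ (z + w) * R 1 := by
      refine tendsto_nhds_unique (tendsto_const_nhds.congr' ?_) hlim
      filter_upwards [Ioc_mem_nhdsGT one_pos] with r hr using (hconst r hr.1 hr.2).symm
    simp only [V, sub_self, Complex.ofReal_zero, zero_mul, add_zero, Complex.ofReal_one,
      one_mul] at hV1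
    rw [mul_sub, sub_eq_zero, h₁.commute 1 h1γ _ (add_mem_openSector hβ₀ hβ hz hw), ← hV1,
      ← mul_assoc, ← mul_assoc, h₁.commute 1 h1γ _ hz]
  refine sub_eq_zero.1 (eq_zero_of_mul_eq_zero (D := fun z => S₁ z * S₂ w - S₁ (z + w))
    (D' := fun z => deriv S₁ z * S₂ w - deriv S₁ (z + w)) (m := 1) hopen (fun v hv => ?_)
    (fun v hv => ?_) key hz)
  · exact ((h₁.hasDerivAt hβ hv).mul_const _).sub
      ((h₁.hasDerivAt hβ (add_mem_openSector hβ₀ hβ hv hw)).comp_add_const v w)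
  · have e1 := h₁.mul_deriv 1 h1γ _ hv
    have e2 := h₁.mul_deriv 1 h1γ _ (add_mem_openSector hβ₀ hβ hv hw)
    simp only [one_smul] at *
    rw [mul_sub, ← mul_assoc, e1, e2, sub_mul, mul_sub, mul_assoc]
    abel

/-- The semigroup is determined by the resolvent. -/
theorem unique (hγ : 0 < γ) (hβ₀ : 0 < β) (hβ : β ≤ π / 2) (h₁ : IsSemigroupOf γ β R S₁)
    (h₂ : IsSemigroupOf γ β R S₂) {z : ℂ} (hz : z ∈ openSector β) : S₁ z = S₂ z := by
  have h1γ : (1 : ℂ) ∈ openSector γ := by simpa using ofReal_mem_openSector hγ one_pos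
  have hopen := isOpen_openSector (γ := β) (by linarith [Real.pi_pos])
  have key : ∀ z ∈ openSector β, R 1 * (S₁ z - S₂ z) = 0 := by
    intro z hz
    -- By `mul_eq` this expression is `R(1) S₁(z)` for every `r` in `(0, 1)`, while `r → 0` turns
    -- the first factor into `R(1)` and the second into `S₂(z)`.
    have hlim : Tendsto (fun r : ℝ => (R 1 * S₁ (r * z)) * S₂ ((1 - r : ℝ) * z)) (𝓝[>] 0)
        (𝓝 (R 1 * S₂ z)) := by
      refine (h₁.tendsto 1 h1γ z hz).mul ?_
      have c1 : ContinuousAt S₂ ((1 - (0 : ℝ) : ℝ) * z) :=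
        (h₂.hasDerivAt hβ (by simpa using hz)).continuousAt
      have c2 : ContinuousAt (fun r : ℝ => ((1 - r : ℝ) : ℂ) * z) 0 := by fun_prop
      have c3 := (ContinuousAt.comp (f := fun r : ℝ => ((1 - r : ℝ) : ℂ) * z) c1 c2).tendsto
      simp only [Function.comp_apply, sub_zero, Complex.ofReal_one, one_mul] at c3
      exact c3.mono_left nhdsWithin_le_nhds
    rw [mul_sub, sub_eq_zero]
    refine tendsto_nhds_unique (tendsto_const_nhds.congr' ?_) hlim
    filter_upwards [Ioo_mem_nhdsGT one_pos] with r hr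
    rw [mul_assoc, mul_eq hγ hβ₀ hβ h₁ h₂ (real_mul_mem_openSector hz hr.1)
      (real_mul_mem_openSector hz (sub_pos.2 hr.2)), ← add_mul]
    simp
  refine sub_eq_zero.1 (eq_zero_of_mul_eq_zero (D := fun z => S₁ z - S₂ z)
    (D' := fun z => deriv S₁ z - deriv S₂ z) (m := 1) hopen (fun v hv => ?_)
    (fun v hv => ?_) key hz)
  · exact (h₁.hasDerivAt hβ hv).sub (h₂.hasDerivAt hβ hv)
  · have e1 := h₁.mul_deriv 1 h1γ _ hv
    have e2 := h₂.mul_deriv 1 h1γ _ hv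
    simp only [one_smul] at *
    rw [mul_sub, e1, e2, mul_sub]
    abel

theorem of_rescale (hβ : β ≤ π / 2) {c : ℝ} (hc : 0 < c)
    (h : IsSemigroupOf γ β (fun l => (c : ℂ) • R (c * l)) S) :
    IsSemigroupOf γ β R fun z => S (c * z) := by
  have hc0 : (c : ℂ) ≠ 0 := by exact_mod_cast hc.ne'
  have hmem : ∀ z ∈ openSector β, (c : ℂ) * z ∈ openSector β := fun z hz =>
    real_mul_mem_openSector hz hc
  have hinv : ∀ m ∈ openSector γ, ((c⁻¹ : ℝ) : ℂ) * m ∈ openSector γ := fun m hm =>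
    real_mul_mem_openSector hm (inv_pos.2 hc)
  have hR : ∀ m : ℂ, R (c * (((c⁻¹ : ℝ) : ℂ) * m)) = R m := fun m => by
    push_cast
    rw [mul_inv_cancel_left₀ hc0]
  have hd : ∀ z ∈ openSector β, HasDerivAt (fun z => S (c * z)) ((c : ℂ) • deriv S (c * z)) z := by
    intro z hz
    have h1 : HasDerivAt (fun z : ℂ => (c : ℂ) * z) c z := by
      simpa using (hasDerivAt_id z).const_mul (c : ℂ)
    exact (h.hasDerivAt hβ (hmem z hz)).scomp z h1
  refine ⟨fun z hz => (hd z hz).differentiableAt.differentiableWithinAt, fun m hm z hz => ?_,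
    fun m hm z hz => ?_, fun m hm z hz => ?_⟩
  · have := h.commute _ (hinv m hm) _ (hmem z hz)
    rw [hR, smul_mul_assoc, mul_smul_comm] at this
    exact smul_right_injective 𝔸 hc0 this
  · have := h.mul_deriv _ (hinv m hm) _ (hmem z hz)
    rw [hR, smul_mul_assoc, smul_mul_assoc, smul_smul] at this
    rw [(hd z hz).deriv, mul_smul_comm, this]
    congr 2
    push_cast
    field_simp
  · have := (h.tendsto _ (hinv m hm) _ (hmem z hz)).const_smul ((c : ℂ)⁻¹)
    simp only [hR, smul_mul_assoc, smul_smul, inv_mul_cancel₀ hc0, one_smul] at this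
    refine this.congr fun r => ?_
    congr 2
    ring

end IsSemigroupOf

end PseudoResolvent

/-! ### The contour integral of the resolvent. -/

section Contour

variable {𝔸 : Type*} [NormedRing 𝔸] [NormedAlgebra ℂ 𝔸] {γ M β : ℝ} {R : ℂ → 𝔸}

/-- The semigroup on the sector of angle `β`, as an integral along a hyperbola. -/
noncomputable def contourSemigroup (β : ℝ) (R : ℂ → 𝔸) (z : ℂ) : 𝔸 :=
  (2 * π * Complex.I : ℂ)⁻¹ • hypIntegral (β + π / 2)
    (fun s => (Complex.sinh (s + (β + π / 2 : ℝ) * Complex.I) / 2) •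
      R (hyp (s + (β + π / 2 : ℝ) * Complex.I))) z

namespace IsPseudoResolvent

theorem hyp_line_mem {y : ℝ} (hγ : γ ≤ π) (hy : |y| < γ) (s : ℝ) :
    hyp (s + y * Complex.I) ∈ openSector γ :=
  hyp_mem_openSector hγ (by simpa using hy)

theorem continuous_comp_hyp (hR : IsPseudoResolvent γ M R) (hγ : γ ≤ π) {y : ℝ} (hy : |y| < γ) :
    Continuous fun s : ℝ => R (hyp (s + y * Complex.I)) := by
  refine continuous_iff_continuousAt.2 fun s => ?_
  exact ContinuousAt.comp (f := fun s : ℝ => hyp (s + y * Complex.I))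
    (hR.continuousAt hγ (hyp_line_mem hγ hy s)) (continuous_hyp_line y).continuousAt

theorem norm_comp_hyp_le (hR : IsPseudoResolvent γ M R) (hγ : γ ≤ π) {y c : ℝ} (hy : |y| < γ)
    (hc₁ : -1 < c) (hc : c ≤ 0) (h : c ≤ Real.cos y) (s : ℝ) :
    ‖R (hyp (s + y * Complex.I))‖ ≤ M * (2 / (1 + c)) * (Real.cosh s)⁻¹ := by
  have hM := hR.nonneg ((abs_nonneg _).trans_lt hy)
  have h1 := le_norm_hyp (s := s) hc h
  have h2 : 0 < (1 + c) / 2 * Real.cosh s := mul_pos (by linarith) (Real.cosh_pos s)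
  refine (hR.norm_le_div (hyp_line_mem hγ hy s)).trans ?_
  calc M / ‖hyp (s + y * Complex.I)‖ ≤ M / ((1 + c) / 2 * Real.cosh s) := by gcongr
    _ = _ := by
      have : 1 + c ≠ 0 := by linarith
      have := (Real.cosh_pos s).ne'
      field_simp

theorem norm_sinh_smul_comp_hyp_le (hR : IsPseudoResolvent γ M R) (hγ : γ ≤ π) {y : ℝ}
    (hy : |y| < γ) (hc₁ : -1 < Real.cos y) (hc : Real.cos y ≤ 0) (s : ℝ) :
    ‖(Complex.sinh (s + y * Complex.I) / 2) • R (hyp (s + y * Complex.I))‖ ≤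
      M * (2 / (1 + Real.cos y)) * Real.cosh s ^ 0 := by
  rw [norm_smul]
  have h1 := norm_sinh_div_two_le s y
  have h2 := hR.norm_comp_hyp_le hγ hy hc₁ hc le_rfl s
  have h3 := Real.cosh_pos s
  calc _ ≤ Real.cosh s * (M * (2 / (1 + Real.cos y)) * (Real.cosh s)⁻¹) := by gcongr
    _ = _ := by rw [pow_zero]; field_simp

/-- Along each hyperbola, the integral of `R(λ) (1 - R(1)) / λ` vanishes. -/
theorem integral_mul_one_sub_eq_zero [CompleteSpace 𝔸] (hR : IsPseudoResolvent γ M R) (hγ : γ ≤ π)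
    {y : ℝ} (hy₀ : 0 ≤ y) (hy : y < γ) (hc : Real.cos y ≤ 0) :
    Integrable (fun s : ℝ => (Complex.sinh (s + y * Complex.I) / 2 / hyp (s + y * Complex.I)) •
      (R (hyp (s + y * Complex.I)) * (1 - R 1))) ∧
    ∫ s : ℝ, (Complex.sinh (s + y * Complex.I) / 2 / hyp (s + y * Complex.I)) •
      (R (hyp (s + y * Complex.I)) * (1 - R 1)) = 0 := by
  have hM := hR.nonneg (hy₀.trans_lt hy)
  set c := Real.cos y
  have hc₁ : -1 < c := by
    rw [← Real.cos_pi]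
    exact Real.cos_lt_cos_of_nonneg_of_le_pi hy₀ le_rfl (hy.trans_le hγ)
  set F : ℂ → 𝔸 := fun w => (Complex.sinh w / 2 / hyp w) • (R (hyp w) * (1 - R 1))
  have hab : ∀ x ∈ uIcc 0 y, |x| < γ ∧ c ≤ Real.cos x := by
    intro x hx
    rw [uIcc_of_le hy₀] at hx
    refine ⟨by rw [abs_of_nonneg hx.1]; linarith [hx.2], ?_⟩
    exact Real.cos_le_cos_of_nonneg_of_le_pi hx.1 (hy.le.trans hγ) hx.2
  have hFd : ∀ w : ℂ, |w.im| < γ → DifferentiableAt ℂ F w := by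
    intro w hw
    have hm := hyp_mem_openSector hγ hw
    have h1 : DifferentiableAt ℂ (fun w => R (hyp w)) w :=
      ((hR.hasDerivAt hγ hm).scomp w (hasDerivAt_hyp w)).differentiableAt
    have h2 : DifferentiableAt ℂ (fun w => Complex.sinh w / 2 / hyp w) w :=
      (DifferentiableAt.div_const (by fun_prop) 2).div (hasDerivAt_hyp w).differentiableAt hm.1
    exact h2.smul (h1.mul_const _)
  set K := 2 / (1 + c) * (M * (2 / (1 + c)) * ‖1 - R 1‖)
  have hK : 0 ≤ 2 / (1 + c) := div_nonneg zero_le_two (by linarith)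
  have hFb : ∀ s : ℝ, ∀ x ∈ uIcc 0 y, ‖F (s + x * Complex.I)‖ ≤ K * (Real.cosh s)⁻¹ := by
    intro s x hx
    obtain ⟨h1, h2⟩ := hab x hx
    have h3 := hR.norm_comp_hyp_le hγ h1 hc₁ hc h2 s
    have h4 := le_norm_hyp (s := s) hc h2
    have h5 := Real.cosh_pos s
    have h6 : ‖Complex.sinh (s + x * Complex.I) / 2 / hyp (s + x * Complex.I)‖ ≤ 2 / (1 + c) := by
      have h0 : 0 < (1 + c) / 2 * Real.cosh s := mul_pos (by linarith) h5
      rw [norm_div, div_le_iff₀ (h0.trans_le h4)]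
      refine (norm_sinh_div_two_le s x).trans ?_
      have h7 : (2 / (1 + c)) * ((1 + c) / 2 * Real.cosh s) = Real.cosh s := by
        have : 1 + c ≠ 0 := by linarith
        field_simp
      calc Real.cosh s = (2 / (1 + c)) * ((1 + c) / 2 * Real.cosh s) := h7.symm
        _ ≤ _ := mul_le_mul_of_nonneg_left h4 hK
    simp only [F]
    rw [norm_smul]
    calc _ ≤ 2 / (1 + c) * (M * (2 / (1 + c)) * (Real.cosh s)⁻¹ * ‖1 - R 1‖) :=
          mul_le_mul h6 ((norm_mul_le _ _).trans
            (mul_le_mul_of_nonneg_right h3 (norm_nonneg _))) (norm_nonneg _) hK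
      _ = _ := by simp only [K]; ring
  have hcont : ∀ x ∈ uIcc 0 y, Continuous fun s : ℝ => F (s + x * Complex.I) := by
    intro x hx
    refine continuous_iff_continuousAt.2 fun s => ?_
    have h1 : ContinuousAt F (s + x * Complex.I) :=
      (hFd _ (by simpa using (hab x hx).1)).continuousAt
    exact ContinuousAt.comp (f := fun s : ℝ => (s + x * Complex.I : ℂ)) h1 (by fun_prop)
  have hint : ∀ x ∈ uIcc 0 y, Integrable fun s : ℝ => F (s + x * Complex.I) := fun x hx =>
    (integrable_inv_cosh.const_mul K).mono' (hcont x hx).aestronglyMeasurable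
      (ae_of_all _ fun s => hFb s x hx)
  have main := integral_horizontal_eq (F := F) (a := 0) (b := y)
    (fun w hw => (hFd w (hab _ hw).1).differentiableWithinAt) hFb
    (by simpa using tendsto_inv_cosh_atTop.const_mul K)
    (by simpa using tendsto_inv_cosh_atBot.const_mul K)
    (hint 0 left_mem_uIcc) (hint y right_mem_uIcc)
  refine ⟨hint y right_mem_uIcc, ?_⟩
  change ∫ s : ℝ, F (s + y * Complex.I) = 0
  rw [← main]
  -- On the line `y = 0` the contour folds onto `[1, ∞)` and is run through in both directions:
  -- `hyp` is even and `sinh` is odd.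
  have hodd : ∀ s : ℝ, F ((-s : ℝ) + (0 : ℝ) * Complex.I) = -F (s + (0 : ℝ) * Complex.I) := by
    intro s
    simp [F, hyp, neg_div]
  have h1 := integral_neg_eq_self (fun s : ℝ => F (s + (0 : ℝ) * Complex.I)) volume
  simp only [hodd] at h1
  rw [integral_neg] at h1
  have h2 : (2 : ℂ) • ∫ s : ℝ, F (s + (0 : ℝ) * Complex.I) = 0 := by
    rw [two_smul]
    nth_rewrite 1 [← h1]
    exact neg_add_cancel _
  exact (smul_eq_zero.1 h2).resolve_left two_ne_zero

/-- The resolvent identity gives `R(λ) / (1 - λ) = (1 / λ + 1 / (1 - λ)) R(1) - R(λ) (1 - R(1)) /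
λ`. The first term integrates to `2πi R(1)` by `integral_sinh_inv`, the second to zero. -/
theorem integral_div_one_sub [CompleteSpace 𝔸] (hR : IsPseudoResolvent γ M R) (hγ : γ ≤ π)
    {y : ℝ} (hy₀ : 0 < y) (hy : y < γ) (hc : Real.cos y < 0) :
    ∫ s : ℝ, (Complex.sinh (s + y * Complex.I) / 2 / (1 - hyp (s + y * Complex.I))) •
      R (hyp (s + y * Complex.I)) = (2 * π * Complex.I : ℂ) • R 1 := by
  have h1γ : (1 : ℂ) ∈ openSector γ := by
    simpa using ofReal_mem_openSector (hy₀.trans hy) one_pos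
  obtain ⟨i1, e1⟩ := integral_sinh_inv hy₀ (hy.trans_le hγ) hc
  obtain ⟨i2, e2⟩ := hR.integral_mul_one_sub_eq_zero hγ hy₀.le hy hc.le
  have e3 : ∀ s : ℝ, (Complex.sinh (s + y * Complex.I) / 2 / (1 - hyp (s + y * Complex.I))) •
      R (hyp (s + y * Complex.I)) =
      (Complex.sinh (s + y * Complex.I) / 2 *
      (1 / hyp (s + y * Complex.I) + 1 / (1 - hyp (s + y * Complex.I)))) • R 1 -
      (Complex.sinh (s + y * Complex.I) / 2 / hyp (s + y * Complex.I)) •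
      (R (hyp (s + y * Complex.I)) * (1 - R 1)) := by
    intro s
    have hm := hyp_line_mem (y := y) hγ (by rwa [abs_of_pos hy₀]) s
    have h0 := hm.1
    have h1 := one_sub_hyp_ne_zero hc s
    have h2 := hR.sub_eq _ hm 1 h1γ
    set l := hyp (s + y * Complex.I)
    set a := Complex.sinh (s + y * Complex.I) / 2
    have h3 : R l * R 1 = (1 - l)⁻¹ • (R l - R 1) := by
      rw [h2, smul_smul, inv_mul_cancel₀ h1, one_smul]
    rw [mul_sub, mul_one, h3]
    match_scalars
    · field_simp
      ring
    · field_simp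
      ring
  simp_rw [e3]
  rw [integral_sub (i1.smul_const _) i2, e2, sub_zero, integral_smul_const, e1]

/-- What matters is the order of quantifiers: `C` is chosen before `R`, so it also serves all
rescaled resolvents. -/
theorem exists_bound_contourSemigroup (hγ : γ ≤ π) (hβ₀ : 0 < β) (hβ : β + π / 2 < γ) {z : ℂ}
    (hz : z ∈ openSector β) :
    ∃ C : ℝ, ∀ R : ℂ → 𝔸, IsPseudoResolvent γ M R → ‖contourSemigroup β R z‖ ≤ C := by
  have hπ := Real.pi_pos
  obtain ⟨κ, hκ, hdec⟩ := exists_hypDecay hβ₀ (by linarith) hz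
  have hy0 : 0 < β + π / 2 := by linarith
  have hcos : Real.cos (β + π / 2) < 0 := by
    rw [Real.cos_add_pi_div_two, neg_lt_zero]
    exact Real.sin_pos_of_pos_of_lt_pi hβ₀ (by linarith)
  have hcos₁ : -1 < Real.cos (β + π / 2) := by
    rw [← Real.cos_pi]
    exact Real.cos_lt_cos_of_nonneg_of_le_pi hy0.le le_rfl (hβ.trans_le hγ)
  refine ⟨‖(2 * π * Complex.I : ℂ)⁻¹‖ * (Real.exp (z.re / 2) *
    ((M * (2 / (1 + Real.cos (β + π / 2))) * ((0 + 1).factorial / (κ / 2) ^ (0 + 1))) *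
      ∫ s : ℝ, (Real.cosh s)⁻¹)), fun R hR => ?_⟩
  rw [contourSemigroup, norm_smul]
  exact mul_le_mul_of_nonneg_left (norm_hypIntegral_le hκ
    (hR.norm_sinh_smul_comp_hyp_le hγ (by rwa [abs_of_pos hy0]) hcos₁ hcos.le) hdec)
    (norm_nonneg _)

variable [CompleteSpace 𝔸]

/-- Everything is the resolvent identity under the integral sign. The differential equation uses `λ
R(m) R(λ) = m R(m) R(λ) + R(m) - R(λ)` and `∫ e^{λz} dλ = 0`. The limit at `0` needs extra decay,
which multiplication by `R(1)` supplies. -/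
theorem isSemigroupOf_contourSemigroup (hR : IsPseudoResolvent γ M R) (hγ : γ ≤ π)
    (hβ₀ : 0 < β) (hβ : β + π / 2 < γ) : IsSemigroupOf γ β R (contourSemigroup β R) := by
  have hπ := Real.pi_pos
  have hβ' : β ≤ π / 2 := by linarith
  have hγ₀ : 0 < γ := by linarith
  have h1γ : (1 : ℂ) ∈ openSector γ := by simpa using ofReal_mem_openSector hγ₀ one_pos
  set y := β + π / 2 with hy_def
  have hy0 : 0 < y := by linarith
  have hyγ : |y| < γ := by rwa [abs_of_pos hy0]
  have hcos : Real.cos y < 0 := by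
    rw [hy_def, Real.cos_add_pi_div_two, neg_lt_zero]
    exact Real.sin_pos_of_pos_of_lt_pi hβ₀ (by linarith)
  have hcos₁ : -1 < Real.cos y := by
    rw [← Real.cos_pi]
    exact Real.cos_lt_cos_of_nonneg_of_le_pi hy0.le le_rfl (hβ.trans_le hγ)
  set p : ℂ := 2 * π * Complex.I with hp_def
  have hp : p ≠ 0 := Complex.two_pi_I_ne_zero
  set k : ℝ → 𝔸 := fun s => (Complex.sinh (s + y * Complex.I) / 2) • R (hyp (s + y * Complex.I))
    with hk_def
  have hS : ∀ z, contourSemigroup β R z = p⁻¹ • hypIntegral y k z := fun z => rfl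
  have hkc : Continuous k := (continuous_sinh_line y).smul (hR.continuous_comp_hyp hγ hyγ)
  have hkb := hR.norm_sinh_smul_comp_hyp_le hγ hyγ hcos₁ hcos.le
  change ∀ s, ‖k s‖ ≤ _ at hkb
  have hD : ∀ z ∈ openSector β, HasDerivAt (contourSemigroup β R)
      (p⁻¹ • hypIntegral y (fun s => hyp (s + y * Complex.I) • k s) z) z := by
    intro z hz
    obtain ⟨κ, hκ, hdec⟩ := exists_hypDecay hβ₀ hβ' hz
    exact (hasDerivAt_hypIntegral hkc hκ hkb hdec).const_smul p⁻¹
  have hmul : ∀ (Q : 𝔸) (k' : ℝ → 𝔸) (z : ℂ), Integrable (fun s : ℝ =>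
      Complex.exp (hyp (s + y * Complex.I) * z) • k' s) →
      Q * hypIntegral y k' z = hypIntegral y (fun s => Q * k' s) z := by
    intro Q k' z hi
    rw [hypIntegral, ← integral_const_mul_of_integrable hi, hypIntegral]
    simp only [mul_smul_comm]
  have hmul' : ∀ (Q : 𝔸) (k' : ℝ → 𝔸) (z : ℂ), Integrable (fun s : ℝ =>
      Complex.exp (hyp (s + y * Complex.I) * z) • k' s) →
      hypIntegral y k' z * Q = hypIntegral y (fun s => k' s * Q) z := by
    intro Q k' z hi
    rw [hypIntegral, ← integral_mul_const_of_integrable hi, hypIntegral]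
    simp only [smul_mul_assoc]
  have hcomm : ∀ m ∈ openSector γ, ∀ z ∈ openSector β,
      R m * contourSemigroup β R z = contourSemigroup β R z * R m := by
    intro m hm z hz
    obtain ⟨κ, hκ, hdec⟩ := exists_hypDecay hβ₀ hβ' hz
    have hi := integrable_exp_hyp_smul hkc hκ hkb hdec
    rw [hS, mul_smul_comm, smul_mul_assoc, hmul _ _ _ hi, hmul' _ _ _ hi]
    congr 2
    ext1 s
    simp only [k]
    rw [mul_smul_comm, smul_mul_assoc, hR.mul_comm hm (hyp_line_mem hγ hyγ s)]
  have hone : ∀ z ∈ openSector β, Tendsto (fun r : ℝ => R 1 * contourSemigroup β R (r * z))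
      (𝓝[>] 0) (𝓝 (R 1)) := by
    intro z hz
    obtain ⟨κ, hκ, hdec⟩ := exists_hypDecay hβ₀ hβ' hz
    -- From `R(1) R(λ) = (R(λ) - R(1)) / (1 - λ)`: the `R(1)` part has zero scalar integral, and the
    -- remaining `R(λ) / (1 - λ)` is integrable against `dλ` even without the exponential.
    set k₁ : ℝ → 𝔸 := fun s => (Complex.sinh (s + y * Complex.I) / 2 /
      (1 - hyp (s + y * Complex.I))) • R (hyp (s + y * Complex.I))
    have hk₁c : Continuous k₁ :=
      (continuous_sinh_div_one_sub_hyp hcos).smul (hR.continuous_comp_hyp hγ hyγ)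
    have hk₁b : ∀ s, ‖k₁ s‖ ≤ 2 * (M * (2 / (1 + Real.cos y))) * (Real.cosh s)⁻¹ := by
      intro s
      simp only [k₁]
      rw [norm_smul, mul_assoc]
      exact mul_le_mul (norm_sinh_div_one_sub_hyp_le hcos s)
        (hR.norm_comp_hyp_le hγ hyγ hcos₁ hcos.le le_rfl s) (norm_nonneg _) zero_le_two
    have hM := hR.nonneg hγ₀
    have hk₁b' : ∀ s, ‖k₁ s‖ ≤ 2 * (M * (2 / (1 + Real.cos y))) * Real.cosh s ^ 0 := by
      intro s
      refine (hk₁b s).trans ?_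
      have h1 : (Real.cosh s)⁻¹ ≤ 1 := inv_le_one_of_one_le₀ (Real.one_le_cosh s)
      have h2 : 0 < 1 + Real.cos y := by linarith
      rw [pow_zero]
      gcongr
    have hzre : 0 < z.re := mem_openSector_pi_div_two.1 (openSector_mono hβ' hz)
    have e1 : ∀ r : ℝ, 0 < r →
        R 1 * contourSemigroup β R (r * z) = p⁻¹ • hypIntegral y k₁ (r * z) := by
      intro r hr
      have hdr := hdec.mul hr.le
      have hrκ : 0 < r * κ := mul_pos hr hκ
      have hi := integrable_exp_hyp_smul hkc hrκ hkb hdr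
      have hJ := hypIntegral_sinh_div_one_sub_hyp hcos hrκ hdr
        (by rw [Complex.re_ofReal_mul]; positivity)
      rw [hS, mul_smul_comm, hmul _ _ _ hi]
      congr 1
      have hJi : Integrable fun s : ℝ => Complex.exp (hyp (s + y * Complex.I) * (r * z)) •
          (Complex.sinh (s + y * Complex.I) / 2 / (1 - hyp (s + y * Complex.I))) :=
        integrable_exp_hyp_smul (n := 0) (C := 2) (continuous_sinh_div_one_sub_hyp hcos) hrκ
          (fun s => by
            simpa only [pow_zero, mul_one] using norm_sinh_div_one_sub_hyp_le hcos s) hdr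
      have e2 : hypIntegral y (fun s => R 1 * k s) (r * z) = hypIntegral y k₁ (r * z) -
          hypIntegral y (fun s => Complex.sinh (s + y * Complex.I) / 2 /
            (1 - hyp (s + y * Complex.I))) (r * z) • R 1 := by
        unfold hypIntegral
        rw [← integral_smul_const, ← integral_sub (integrable_exp_hyp_smul hk₁c hrκ hk₁b' hdr)
          (hJi.smul_const _)]
        congr 1
        ext1 s
        have hm := hyp_line_mem (y := y) hγ hyγ s
        have h1 := one_sub_hyp_ne_zero hcos s
        have h2 := hR.sub_eq _ hm 1 h1γ
        simp only [k, k₁]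
        rw [mul_smul_comm, hR.mul_comm h1γ hm]
        set l := hyp (s + y * Complex.I)
        have h3 : R l * R 1 = (1 - l)⁻¹ • (R l - R 1) := by
          rw [h2, smul_smul, inv_mul_cancel₀ h1, one_smul]
        rw [h3, smul_eq_mul]
        match_scalars <;> field_simp
      rw [e2, hJ, zero_smul, sub_zero]
    have hlim : Tendsto (fun r : ℝ => hypIntegral y k₁ (r * z)) (𝓝[>] 0) (𝓝 (∫ s, k₁ s)) := by
      refine tendsto_integral_filter_of_dominated_convergence
        (fun s => Real.exp (z.re / 2) * (2 * (M * (2 / (1 + Real.cos y))) * (Real.cosh s)⁻¹))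
        (Eventually.of_forall fun r => (continuous_exp_hyp_smul hk₁c _).aestronglyMeasurable) ?_
        ((integrable_inv_cosh.const_mul _).const_mul _) (ae_of_all _ fun s => ?_)
      · filter_upwards [Ioc_mem_nhdsGT one_pos] with r hr
        refine ae_of_all _ fun s => ?_
        -- The decay constant `r κ` degenerates as `r → 0`; constant `0` suffices, since `k₁` is
        -- dominated by a multiple of `1 / cosh`.
        have hd0 : HypDecay y 0 (r * z) :=
          (hdec.mul hr.1.le).mono (mul_nonneg hr.1.le hκ.le)
        have h1 := re_hyp_mul_le hd0.1 hd0.2 s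
        rw [norm_smul, Complex.norm_exp]
        refine mul_le_mul (Real.exp_le_exp.2 (h1.trans ?_)) (hk₁b s) (norm_nonneg _)
          (Real.exp_pos _).le
        rw [Complex.re_ofReal_mul]
        nlinarith [hr.2]
      · have hc : Continuous fun r : ℝ =>
            Complex.exp (hyp (s + y * Complex.I) * (r * z)) • k₁ s := by fun_prop
        simpa using (hc.tendsto 0).mono_left nhdsWithin_le_nhds
    have hval := hR.integral_div_one_sub hγ hy0 hβ hcos
    have h2 := hlim.const_smul p⁻¹
    change ∫ s, k₁ s = _ at hval
    rw [hval, smul_smul, inv_mul_cancel₀ hp, one_smul] at h2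
    refine h2.congr' ?_
    filter_upwards [self_mem_nhdsWithin] with r hr using (e1 r hr).symm
  refine ⟨fun z hz => (hD z hz).differentiableAt.differentiableWithinAt, hcomm,
    fun m hm z hz => ?_, fun m hm z hz => ?_⟩
  · obtain ⟨κ, hκ, hdec⟩ := exists_hypDecay hβ₀ hβ' hz
    have hi := integrable_exp_hyp_smul hkc hκ hkb hdec
    have hkc' : Continuous fun s : ℝ => hyp (s + y * Complex.I) • k s :=
      (continuous_hyp_line y).smul hkc
    have hi' := integrable_exp_hyp_smul hkc' hκ (norm_hyp_smul_le hkb) hdec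
    have hsi : Integrable fun s : ℝ => Complex.exp (hyp (s + y * Complex.I) * z) •
        (Complex.sinh (s + y * Complex.I) / 2) :=
      integrable_exp_hyp_smul (n := 1) (C := 1) (continuous_sinh_line y) hκ
        (fun s => by simpa using norm_sinh_div_two_le s y) hdec
    have h0 := hypIntegral_sinh hκ hdec
    rw [(hD z hz).deriv, hS, mul_smul_comm, mul_smul_comm, hmul _ _ _ hi', hmul _ _ _ hi,
      smul_comm m, ← smul_sub]
    congr 1
    have e : hypIntegral y (fun s => R m * hyp (s + y * Complex.I) • k s) z =
        m • hypIntegral y (fun s => R m * k s) z - hypIntegral y k z +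
        hypIntegral y (fun s => Complex.sinh (s + y * Complex.I) / 2) z • R m := by
      have hi2 : Integrable fun s : ℝ => Complex.exp (hyp (s + y * Complex.I) * z) •
          (R m * k s) := by
        simpa only [mul_smul_comm] using hi.const_mul (R m)
      have hi3 : Integrable fun s : ℝ => m • (Complex.exp (hyp (s + y * Complex.I) * z) •
          (R m * k s)) := hi2.smul m
      have hi4 : Integrable fun s : ℝ => m • (Complex.exp (hyp (s + y * Complex.I) * z) •
          (R m * k s)) - Complex.exp (hyp (s + y * Complex.I) * z) • k s := hi3.sub hi
      unfold hypIntegral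
      rw [← integral_smul_const, ← integral_smul, ← integral_sub hi3 hi,
        ← integral_add hi4 (hsi.smul_const _)]
      congr 1
      ext1 s
      have hl := hyp_line_mem (y := y) hγ hyγ s
      have h2 := hR.sub_eq _ hm _ hl
      simp only [k]
      set l := hyp (s + y * Complex.I)
      simp only [mul_smul_comm]
      have h3 : l • (R m * R l) = m • (R m * R l) + (R m - R l) := by
        rw [h2, sub_smul]; abel
      rw [smul_comm l, h3]
      match_scalars <;> ring
    rw [e, h0, zero_smul, add_zero]
  · have h1 := hone z hz
    have h2 := hR.sub_eq _ hm 1 h1γ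
    -- The limit for a general `m` follows from the one for `1`, as `R(m)` is a left multiple of
    -- `R(1)`.
    have h3 : R m = R 1 + (1 - m) • (R m * R 1) := by rw [← h2]; abel
    have h4 := h1.add ((h1.const_mul (R m)).const_smul (1 - m))
    rw [← h3] at h4
    refine h4.congr fun r => ?_
    conv_rhs => rw [h3]
    rw [add_mul, smul_mul_assoc, mul_assoc]

/-- The contour semigroup is bounded on each ray. -/
theorem exists_bound_ray (hR : IsPseudoResolvent γ M R) (hγ : γ ≤ π) (hβ₀ : 0 < β)
    (hβ : β + π / 2 < γ) {z : ℂ} (hz : z ∈ openSector β) :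
    ∃ C : ℝ, ∀ t : ℝ, 0 < t → ‖contourSemigroup β R (t * z)‖ ≤ C := by
  have hπ := Real.pi_pos
  obtain ⟨C, hC⟩ := exists_bound_contourSemigroup (𝔸 := 𝔸) (M := M) hγ hβ₀ hβ hz
  refine ⟨C, fun t ht => ?_⟩
  have hc := inv_pos.2 ht
  -- With `c = 1 / t`, uniqueness identifies the value at `t z` with the contour integral of the
  -- rescaled resolvent at `c t z = z`.
  have h1 := ((hR.rescale hc).isSemigroupOf_contourSemigroup hγ hβ₀ hβ).of_rescale
    (by linarith) hc
  have h2 := (hR.isSemigroupOf_contourSemigroup hγ hβ₀ hβ).unique (by linarith) hβ₀ (by linarith)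
    h1 (real_mul_mem_openSector hz ht)
  rw [h2]
  have h3 : ((t⁻¹ : ℝ) : ℂ) * (t * z) = z := by
    push_cast
    rw [inv_mul_cancel_left₀ (by exact_mod_cast ht.ne')]
  rw [h3]
  exact hC _ (hR.rescale hc)

end IsPseudoResolvent

end Contour

/-! ### Laplace transforms recovered from the differential equation. -/

section RayLaplace

variable {𝔸 : Type*} [NormedRing 𝔸] [NormedAlgebra ℂ 𝔸] [CompleteSpace 𝔸]

/-- The Laplace transform of `S` and of `t S(t)`, if `Q S' = μ Q S - S` and `Q S(t) → Q`. -/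
theorem laplace_eq_of_mul_deriv {S S' : ℝ → 𝔸} {Q : 𝔸} {μ : ℂ} {C : ℝ} (hμ : 0 < μ.re)
    (hd : ∀ t, 0 < t → HasDerivAt S (S' t) t)
    (hS' : ∀ t, 0 < t → Q * S' t = μ • (Q * S t) - S t) (hC : ∀ t, 0 < t → ‖S t‖ ≤ C)
    (h0 : Tendsto (fun t => Q * S t) (𝓝[>] 0) (𝓝 Q)) :
    laplace S μ = Q ∧
      ∫ t in Ioi (0 : ℝ), Complex.exp (-(μ * t)) • ((t : ℂ) • S t) = Q * Q := by
  have hSc : ContinuousOn S (Ioi 0) := fun t ht => (hd t ht).continuousAt.continuousWithinAt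
  have hC0 : 0 ≤ C := (norm_nonneg _).trans (hC 1 one_pos)
  have hexp : ∀ t : ℝ, HasDerivAt (fun t : ℝ => Complex.exp (-(μ * t)))
      (Complex.exp (-(μ * t)) * (-μ)) t := by
    intro t
    have := ((hasDerivAt_id (t : ℂ)).const_mul μ).neg.cexp.comp_ofReal
    simpa using this
  have hexp0 : Tendsto (fun t : ℝ => Complex.exp (-(μ * t))) (𝓝[>] 0) (𝓝 1) := by
    have hc : Continuous fun t : ℝ => Complex.exp (-(μ * t)) := by fun_prop
    simpa using (hc.tendsto 0).mono_left nhdsWithin_le_nhds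
  have hQS : ∀ P : 𝔸, ∀ t, 0 < t → ‖P * S t‖ ≤ ‖P‖ * C := fun P t ht =>
    (norm_mul_le _ _).trans (mul_le_mul_of_nonneg_left (hC t ht) (norm_nonneg _))
  have hQd : ∀ t, 0 < t → HasDerivAt (fun t => Q * S t) (μ • (Q * S t) - S t) t := fun t ht =>
    ((hd t ht).const_mul Q).congr_deriv (hS' t ht)
  constructor
  · have hfd : ∀ t : ℝ, 0 < t → HasDerivAt (fun t : ℝ => -(Complex.exp (-(μ * t)) • (Q * S t)))
        (Complex.exp (-(μ * t)) • S t) t := by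
      intro t ht
      refine ((hexp t).smul (hQd t ht)).neg.congr_deriv ?_
      module
    have hlim0 : Tendsto (fun t : ℝ => -(Complex.exp (-(μ * t)) • (Q * S t))) (𝓝[>] 0)
        (𝓝 (-Q)) := by
      simpa using (hexp0.smul h0).neg
    have hlim : Tendsto (fun t : ℝ => -(Complex.exp (-(μ * t)) • (Q * S t))) atTop (𝓝 0) := by
      simpa using (tendsto_exp_neg_mul_smul_atTop (hQS Q) hμ).neg
    have := integral_Ioi_zero_of_tendsto hfd (integrableOn_laplace hSc hC hμ) hlim0 hlim
    rw [laplace, this]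
    abel
  · have hint : IntegrableOn (fun t : ℝ => Complex.exp (-(μ * t)) • ((t : ℂ) • S t)) (Ioi 0) := by
      have h1 : IntegrableOn (fun t : ℝ => C * (t * Real.exp (-μ.re * t))) (Ioi 0) := by
        have := (integrableOn_rpow_mul_exp_neg_mul_rpow (p := 1) (s := 1) (b := μ.re) (by norm_num)
          (by norm_num) hμ).const_mul C
        simpa [IntegrableOn] using this
      refine Integrable.mono' h1 (ContinuousOn.aestronglyMeasurable
        (ContinuousOn.smul (by fun_prop) (ContinuousOn.smul (by fun_prop) hSc))
        measurableSet_Ioi) ?_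
      filter_upwards [ae_restrict_mem measurableSet_Ioi] with t ht
      have ht' : (0 : ℝ) < t := ht
      have := norm_exp_neg_mul_smul_le hC μ ht'
      rw [smul_comm, norm_smul, Complex.norm_real, Real.norm_of_nonneg ht'.le]
      nlinarith
    -- Integration by parts in closed form; the second summand compensates the derivative of `t` and
    -- leaves `Q²` at the endpoint `0`.
    have hfd : ∀ t : ℝ, 0 < t → HasDerivAt (fun t : ℝ => -((t : ℂ) • (Complex.exp (-(μ * t)) •
        (Q * S t)) + Complex.exp (-(μ * t)) • (Q * (Q * S t))))
        (Complex.exp (-(μ * t)) • ((t : ℂ) • S t)) t := by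
      intro t ht
      have e1 := (hexp t).smul (hQd t ht)
      have e2 := ((hasDerivAt_id (t : ℂ)).comp_ofReal).smul e1
      have e3 := (hexp t).smul ((hQd t ht).const_mul Q)
      refine (e2.add e3).neg.congr_deriv ?_
      simp only [mul_sub, mul_smul_comm, id, Pi.smul_apply']
      module
    have ht0 : Tendsto (fun t : ℝ => (t : ℂ)) (𝓝[>] 0) (𝓝 0) := by
      simpa using (Complex.continuous_ofReal.tendsto 0).mono_left nhdsWithin_le_nhds
    have hlim0 : Tendsto (fun t : ℝ => -((t : ℂ) • (Complex.exp (-(μ * t)) •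
        (Q * S t)) + Complex.exp (-(μ * t)) • (Q * (Q * S t)))) (𝓝[>] 0) (𝓝 (-(Q * Q))) := by
      simpa using ((ht0.smul (hexp0.smul h0)).add (hexp0.smul (h0.const_mul Q))).neg
    have hlim : Tendsto (fun t : ℝ => -((t : ℂ) • (Complex.exp (-(μ * t)) •
        (Q * S t)) + Complex.exp (-(μ * t)) • (Q * (Q * S t)))) atTop (𝓝 0) := by
      have l1 : Tendsto (fun t : ℝ => (t : ℂ) • (Complex.exp (-(μ * t)) • (Q * S t))) atTop
          (𝓝 0) := by
        have h1 : Tendsto (fun t : ℝ => (‖Q‖ * C) * (t * Real.exp (-μ.re * t))) atTop (𝓝 0) := by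
          have : Tendsto (fun u : ℝ => u * Real.exp (-μ.re * u)) atTop (𝓝 0) := by
            simpa using tendsto_rpow_mul_exp_neg_mul_atTop_nhds_zero 1 μ.re hμ
          simpa using this.const_mul (‖Q‖ * C)
        refine squeeze_zero_norm' ?_ h1
        filter_upwards [eventually_gt_atTop 0] with t ht
        have := norm_exp_neg_mul_smul_le (hQS Q) μ ht
        rw [norm_smul, Complex.norm_real, Real.norm_of_nonneg ht.le]
        nlinarith
      have l2 := tendsto_exp_neg_mul_smul_atTop (S := fun t => Q * (Q * S t))
        (fun t ht => by simpa only [mul_assoc] using hQS (Q * Q) t ht) hμ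
      simpa using (l1.add l2).neg
    rw [integral_Ioi_zero_of_tendsto hfd hint hlim0 hlim]
    abel

end RayLaplace

/-! ### The semigroup on the full sector and its norm bounds. -/

section SectorialGeneration

variable {𝔸 : Type*} [NormedRing 𝔸] [NormedAlgebra ℂ 𝔸] [CompleteSpace 𝔸] {α M : ℝ} {R : ℂ → 𝔸}

/-- The semigroup on `Σ_α` generated by a pseudo-resolvent on `Σ_{α + π / 2}`. -/
noncomputable def sectorialSemigroup (α : ℝ) (R : ℂ → 𝔸) (z : ℂ) : 𝔸 :=
  contourSemigroup ((|z.arg| + α) / 2) R z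

namespace IsPseudoResolvent

/-- The contour angle in the definition varies with `z`. Both contour integrals are semigroups of
the same `R` on the smaller of the two sectors, so they agree there; hence locally the angle may be
frozen, which gives holomorphy. -/
theorem sectorialSemigroup_eq (hα : α ≤ π / 2) (hR : IsPseudoResolvent (α + π / 2) M R) {β : ℝ}
    (hβ : β < α) {z : ℂ} (hz : z ∈ openSector β) :
    sectorialSemigroup α R z = contourSemigroup β R z := by
  have hπ := Real.pi_pos
  have h0 := abs_nonneg z.arg
  have hz2 := hz.2
  have h1 := hR.isSemigroupOf_contourSemigroup (by linarith) (β := β) (by linarith) (by linarith)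
  have h2 := hR.isSemigroupOf_contourSemigroup (by linarith) (β := (|z.arg| + α) / 2)
    (by linarith) (by linarith)
  have hm : |z.arg| < min β ((|z.arg| + α) / 2) := lt_min hz2 (by linarith)
  have hmle := min_le_left β ((|z.arg| + α) / 2)
  exact (h2.mono (min_le_right β _)).unique (by linarith) (by linarith) (by linarith)
    (h1.mono (min_le_left β _)) ⟨hz.1, hm⟩

theorem isSemigroupOf_sectorialSemigroup (hα : α ≤ π / 2)
    (hR : IsPseudoResolvent (α + π / 2) M R) :
    IsSemigroupOf (α + π / 2) α R (sectorialSemigroup α R) := by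
  have hπ := Real.pi_pos
  have key : ∀ z ∈ openSector α, ∃ β, 0 < β ∧ β < α ∧ z ∈ openSector β := by
    intro z hz
    have h0 := abs_nonneg z.arg
    have := hz.2
    exact ⟨(|z.arg| + α) / 2, by linarith, by linarith, hz.1, by linarith⟩
  have hev : ∀ β, 0 < β → β < α → ∀ z ∈ openSector β,
      sectorialSemigroup α R =ᶠ[𝓝 z] contourSemigroup β R := by
    intro β _ hβ z hz
    filter_upwards [(isOpen_openSector (by linarith)).mem_nhds hz] with w hw
    exact hR.sectorialSemigroup_eq hα hβ hw
  refine ⟨fun z hz => ?_, fun m hm z hz => ?_, fun m hm z hz => ?_, fun m hm z hz => ?_⟩ <;>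
    obtain ⟨β, hβ₀, hβ, hzβ⟩ := key z hz <;>
    have h := hR.isSemigroupOf_contourSemigroup (by linarith) hβ₀ (by linarith)
  · exact ((h.hasDerivAt (by linarith) hzβ).congr_of_eventuallyEq
      (hev β hβ₀ hβ z hzβ)).differentiableAt.differentiableWithinAt
  · rw [hR.sectorialSemigroup_eq hα hβ hzβ]
    exact h.commute m hm z hzβ
  · rw [(hev β hβ₀ hβ z hzβ).deriv_eq, hR.sectorialSemigroup_eq hα hβ hzβ]
    exact h.mul_deriv m hm z hzβ
  · refine (h.tendsto m hm z hzβ).congr' ?_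
    filter_upwards [self_mem_nhdsWithin] with r hr
    rw [hR.sectorialSemigroup_eq hα hβ (real_mul_mem_openSector hzβ hr)]

theorem exists_bound_sectorialSemigroup_ray (hα : α ≤ π / 2)
    (hR : IsPseudoResolvent (α + π / 2) M R) {z : ℂ} (hz : z ∈ openSector α) :
    ∃ C : ℝ, ∀ t : ℝ, 0 < t → ‖sectorialSemigroup α R (t * z)‖ ≤ C := by
  have hπ := Real.pi_pos
  have h0 := abs_nonneg z.arg
  have hz2 := hz.2
  have hzβ : z ∈ openSector ((|z.arg| + α) / 2) := ⟨hz.1, by linarith⟩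
  obtain ⟨C, hC⟩ := hR.exists_bound_ray (by linarith) (β := (|z.arg| + α) / 2) (by linarith)
    (by linarith) hzβ
  refine ⟨C, fun t ht => ?_⟩
  rw [hR.sectorialSemigroup_eq hα (by linarith) (real_mul_mem_openSector hzβ ht)]
  exact hC t ht

theorem rotated_mem {θ : ℝ} (hα : α ≤ π / 2) (hθ : |θ| < α) {μ : ℂ} (hμ : 0 < μ.re) :
    Complex.exp ((-θ : ℝ) * Complex.I) * μ ∈ openSector (α + π / 2) :=
  mul_mem_openSector (by linarith)
    (exp_mem_openSector (by rwa [abs_neg]) (by rw [abs_neg]; linarith [Real.pi_pos]))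
    (mem_openSector_pi_div_two.2 hμ)

/-- The Laplace transforms of `T` and of `t T` along a ray. -/
theorem laplace_sectorialSemigroup (hα : α ≤ π / 2) (hR : IsPseudoResolvent (α + π / 2) M R)
    {θ : ℝ} (hθ : |θ| < α) {μ : ℂ} (hμ : 0 < μ.re) :
    laplace (fun t : ℝ => sectorialSemigroup α R (t * Complex.exp (θ * Complex.I))) μ =
      Complex.exp ((-θ : ℝ) * Complex.I) • R (Complex.exp ((-θ : ℝ) * Complex.I) * μ) ∧
    ∫ t in Ioi (0 : ℝ), Complex.exp (-(μ * t)) •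
      ((t : ℂ) • sectorialSemigroup α R (t * Complex.exp (θ * Complex.I))) =
      (Complex.exp ((-θ : ℝ) * Complex.I) • R (Complex.exp ((-θ : ℝ) * Complex.I) * μ)) *
      (Complex.exp ((-θ : ℝ) * Complex.I) • R (Complex.exp ((-θ : ℝ) * Complex.I) * μ)) := by
  have hT := hR.isSemigroupOf_sectorialSemigroup hα
  have hm := rotated_mem hα hθ hμ
  set a := Complex.exp (θ * Complex.I)
  set b := Complex.exp ((-θ : ℝ) * Complex.I)
  have hab : b * a = 1 := by
    simp only [a, b]
    rw [← Complex.exp_add]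
    simp
  have ha : a ∈ openSector α := exp_mem_openSector hθ (by linarith [Real.pi_pos])
  obtain ⟨C, hC⟩ := hR.exists_bound_sectorialSemigroup_ray hα ha
  refine laplace_eq_of_mul_deriv hμ
    (S' := fun t => a • deriv (sectorialSemigroup α R) (t * a)) (fun t ht => ?_) (fun t ht => ?_)
    hC ?_
  · have a2 : HasDerivAt (fun t : ℝ => (t : ℂ) * a) a t := by
      have : HasDerivAt (fun r : ℂ => r * a) a (t : ℂ) := by
        simpa using (hasDerivAt_id (t : ℂ)).mul_const a
      exact this.comp_ofReal
    exact (hT.hasDerivAt hα (real_mul_mem_openSector ha ht)).scomp t a2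
  · have h1 := hT.mul_deriv _ hm _ (real_mul_mem_openSector ha ht)
    rw [smul_mul_smul_comm, hab, one_smul, h1, smul_mul_assoc, smul_smul, _root_.mul_comm b]
  · simpa [smul_mul_assoc] using (hT.tendsto _ hm _ ha).const_smul b

/-- On the ray through `z`, the transform of `t T` is a unimodular multiple of `R²`, so
`norm_le_of_laplace_bound` applies. The ray bound from the contour only secures convergence and
leaves no trace in the constant. -/
theorem norm_sectorialSemigroup_le (hα : α ≤ π / 2) (hR : IsPseudoResolvent (α + π / 2) M R)
    {B : ℝ} {z : ℂ} (hz : z ∈ openSector α)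
    (hB : ∀ μ : ℂ, 0 < μ.re → ‖R (Complex.exp ((-z.arg : ℝ) * Complex.I) * μ) *
      R (Complex.exp ((-z.arg : ℝ) * Complex.I) * μ)‖ ≤ B / ‖μ‖ ^ 2) :
    ‖sectorialSemigroup α R z‖ ≤ Real.exp 1 / 2 * B := by
  have hT := hR.isSemigroupOf_sectorialSemigroup hα
  have ha : Complex.exp (z.arg * Complex.I) ∈ openSector α :=
    exp_mem_openSector hz.2 (hz.2.trans_le (by linarith [Real.pi_pos]))
  obtain ⟨C, hC⟩ := hR.exists_bound_sectorialSemigroup_ray hα ha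
  have h := norm_le_of_laplace_bound
    (S := fun t : ℝ => sectorialSemigroup α R (t * Complex.exp (z.arg * Complex.I))) (B := B)
    (hT.differentiableOn.continuousOn.comp (by fun_prop)
      fun _ ht => real_mul_mem_openSector ha ht) hC (fun μ hμ => ?_) (norm_pos_iff.2 hz.1)
  · simpa only [norm_mul_exp_arg] using h
  · rw [(hR.laplace_sectorialSemigroup hα hz.2 hμ).2, smul_mul_smul_comm, norm_smul, norm_mul,
      Complex.norm_exp_ofReal_mul_I, mul_one, one_mul]
    exact hB μ hμ

end IsPseudoResolvent

end SectorialGeneration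

/-! ### Part (a): sectorial relations generate. -/

section SectorialRelation

variable {X : Type*} [NormedAddCommGroup X] [NormedSpace ℂ X] [CompleteSpace X] {α M : ℝ}

theorem LinRel.isPseudoResolvent {γ : ℝ} {A : LinRel X} (hA : openSector γ ⊆ A.resolventSet)
    (hM : ∀ μ ∈ openSector γ, ‖μ • A.resolvent μ‖ ≤ M) :
    IsPseudoResolvent γ M A.resolvent := by
  refine ⟨fun l hl m hm => ?_, fun l hl => by simpa [norm_smul] using hM l hl⟩
  have h := (hasResolvent_resolvent (hA hm)).resolvent_sub (hasResolvent_resolvent (hA hl))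
  rw [← neg_sub, h, ← neg_smul, neg_sub]

/-- Sectorial relations generate bounded holomorphic semigroups. -/
theorem LinRel.exists_isHolomorphicSemigroup (hα₀ : 0 < α) (hα : α ≤ π / 2) {A : LinRel X}
    (hA : openSector (α + π / 2) ⊆ A.resolventSet)
    (hM : ∀ μ ∈ openSector (α + π / 2), ‖μ • A.resolvent μ‖ ≤ M) :
    ∃ T : ℂ → X →L[ℂ] X,
      IsHolomorphicSemigroup α T ∧
      IsGenerator A (fun t : ℝ => T (t : ℂ)) ∧
      (∃ C : ℝ, ∀ z ∈ openSector α, ‖T z‖ ≤ C) ∧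
      ∀ ε : ℝ, 0 < ε → ε < α → ∀ z ∈ openSector (α - ε),
        ‖T z‖ ≤ M * (1 + 2 * Real.exp 1 * π / Real.sin ε) := by
  have hπ := Real.pi_pos
  have hR := isPseudoResolvent hA hM
  have hM0 := hR.nonneg (by linarith)
  have hT := hR.isSemigroupOf_sectorialSemigroup hα
  have hnorm : ∀ (θ : ℝ) (μ : ℂ), ‖Complex.exp ((-θ : ℝ) * Complex.I) * μ‖ = ‖μ‖ := fun θ μ => by
    rw [norm_mul, Complex.norm_exp_ofReal_mul_I, one_mul]
  -- Each half plane rotated by less than `α` lies in the sector of angle `α + π / 2`, so `‖R²‖ ≤ M²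
  -- / |μ|²` is available uniformly up to the boundary.
  have hbound : ∀ z ∈ openSector α,
      ‖sectorialSemigroup α A.resolvent z‖ ≤ Real.exp 1 / 2 * M ^ 2 := fun z hz =>
    hR.norm_sectorialSemigroup_le hα hz fun μ hμ => by
      have := hR.norm_sq_le (IsPseudoResolvent.rotated_mem hα hz.2 hμ)
      rwa [hnorm] at this
  refine ⟨sectorialSemigroup α A.resolvent, ⟨hT.differentiableOn, fun z hz w hw => ?_⟩, ?_,
    ⟨_, hbound⟩, fun ε hε hε' z hz => ?_⟩
  · exact (hT.mul_eq (by linarith) hα₀ hα hT hz hw).symm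
  · refine isGenerator_of_hasResolvent (M := Real.exp 1 / 2 * M ^ 2)
      (hT.differentiableOn.continuousOn.comp (by fun_prop)
        fun _ ht => ofReal_mem_openSector hα₀ ht)
      (fun t ht => hbound _ (ofReal_mem_openSector hα₀ ht)) fun μ hμ => ?_
    have h1 := (hR.laplace_sectorialSemigroup hα (θ := 0) (by simpa using hα₀) (μ := μ)
      (by simpa using hμ)).1
    simp only [Complex.ofReal_zero, zero_mul, Complex.exp_zero, mul_one, neg_zero, one_mul,
      one_smul] at h1
    rw [h1]
    exact hasResolvent_resolvent (hA (ofReal_mem_openSector (by linarith) hμ))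
  · have hs : 0 < Real.sin ε := Real.sin_pos_of_pos_of_lt_pi hε (by linarith)
    have h := hR.norm_sectorialSemigroup_le hα (B := 4 * M / Real.sin ε)
      (openSector_mono (by linarith) hz) fun μ hμ => by
        have hz2 := hz.2
        -- For `z` in the smaller sector the rotated half plane keeps angular distance `ε` from the
        -- boundary, as the Cauchy estimate requires.
        have hmem : Complex.exp ((-z.arg : ℝ) * Complex.I) * μ ∈
            openSector (α + π / 2 - ε) := by
          have := mul_mem_openSector (a := α - ε) (b := π / 2) (by linarith)
            (exp_mem_openSector (θ := -z.arg) (by rwa [abs_neg]) (by rw [abs_neg]; linarith))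
            (mem_openSector_pi_div_two.2 hμ)
          rwa [show α - ε + π / 2 = α + π / 2 - ε by ring] at this
        have := hR.norm_sq_le_of_sin hα hε hε' hmem
        rwa [hnorm] at this
    refine h.trans ?_
    have he := Real.exp_pos 1
    -- The argument yields `2 e M / sin ε`, which is weakened to the required constant.
    calc Real.exp 1 / 2 * (4 * M / Real.sin ε) = M * (2 * Real.exp 1 * 1 / Real.sin ε) := by
          field_simp
          ring
      _ ≤ M * (2 * Real.exp 1 * π / Real.sin ε) := by
          gcongr
          linarith [Real.pi_gt_three]
      _ ≤ _ := by gcongr; linarith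

end SectorialRelation

theorem mainTheorem9 {X : Type*} [NormedAddCommGroup X] [NormedSpace ℂ X] [CompleteSpace X]
    (α : ℝ) (hα₀ : 0 < α) (hα : α ≤ π / 2) (M : ℝ) (hM : 0 < M) :
    (∀ A : LinRel X, IsClosed (A : Set (X × X)) →
      openSector (α + π / 2) ⊆ A.resolventSet →
      (∀ μ ∈ openSector (α + π / 2), ‖μ • A.resolvent μ‖ ≤ M) →
      ∃ T : ℂ → X →L[ℂ] X,
        IsHolomorphicSemigroup α T ∧
        IsGenerator A (fun t : ℝ => T (t : ℂ)) ∧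
        (∃ C : ℝ, ∀ z ∈ openSector α, ‖T z‖ ≤ C) ∧
        ∀ ε : ℝ, 0 < ε → ε < α → ∀ z ∈ openSector (α - ε),
          ‖T z‖ ≤ M * (1 + 2 * Real.exp 1 * π / Real.sin ε)) ∧
    (∀ T : ℂ → X →L[ℂ] X, IsHolomorphicSemigroup α T →
      (∀ z ∈ openSector α, ‖T z‖ ≤ M) →
      (∃! A : LinRel X, IsGenerator A (fun t : ℝ => T (t : ℂ))) ∧
      ∀ A : LinRel X, IsGenerator A (fun t : ℝ => T (t : ℂ)) →
        openSector (α + π / 2) ⊆ A.resolventSet ∧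
        ∀ ε : ℝ, 0 < ε → ε < π / 2 → ∀ μ ∈ openSector (α + π / 2 - ε),
          ‖μ • A.resolvent μ‖ ≤ M * (1 / Real.sin ε)) :=
  ⟨fun _ _ hA hAM => LinRel.exists_isHolomorphicSemigroup hα₀ hα hA hAM,
    fun _ hT hTM => hT.generator hα₀ hα hTM⟩
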